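/- **Setting.** Let $q_0=(\tfrac1{\sqrt3},1)$, $q_1=(0,0)$, $q_2=(\tfrac2{\sqrt3},0)$ be the vertices of an equilateral triangle, and set $F_i(z)=\tfrac13z+\tfrac23q_i$ for $i=0,1,2$, $F_3(z)=\tfrac13z+\tfrac13(q_1+q_2)$, $F_4(z)=\tfrac13z+\tfrac13(q_0+q_2)$, $F_5(z)=\tfrac13z+\tfrac13(q_0+q_1)$. The level-3 Sierpinski gasket $\mathcal{SG}_3$ is the unique nonempty compact set with $\mathcal{SG}_3=\bigcup_{i=0}^5F_i\mathcal{SG}_3$. For a word $w=w_1\cdots w_m$ in the letters $0,\dots,5$ write $|w|=m$ and $F_w=F_{w_1}\circ\cdots\circ F_{w_m}$; the sets $F_w\mathcal{SG}_3$ with $|w|=m$ are the $m$-cells. Put $V_0=\{q_0,q_1,q_2\}$ and $V_m=\bigcup_iF_iV_{m-1}$, and for $x\ne y$ in $V_m$ write $x\sim_my$ if $x$ and $y$ are vertices of a common $m$-cell. The half domain $\Omega$ is the set of points of $\mathcal{SG}_3\setminus V_0$ lying strictly to the left of the vertical line through $q_0$. Its boundary is $\partial\Omega=\{q_1\}\cup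 X$, where $X$ is the intersection of $\mathcal{SG}_3$ with this line; put $\bar\Omega=\Omega\cup\partial\Omega$. A function $u$ on $\bar\Omega$ is called harmonic in $\Omega$ if $\sum_{y\sim_mx}(u(x)-u(y))=0$ for every $m$ and every $x\in V_m\cap\Omega$ such that all $m$-cells containing $x$ lie in $\bar\Omega$. Its energy $\mathcal E(u)\in[0,\infty]$ on $\Omega$ is the limit, as $m\to\infty$, of the nondecreasing sequence $$\Big(\frac{15}{7}\Big)^m\sum\big(u(x)-u(y)\big)^2,$$ where the sum runs over the edges $x\sim_my$ of the $m$-cells contained in $\bar\Omega$. Let $\tilde W_*$ be the set of all finite words in the letters $0$ and $3$, including the empty word $\emptyset$, and let $p_w=F_wF_3q_0$ for $w\in\tilde W_*$; these points lie in $X$. For a continuous function $f:\partial\Omega\to\mathbb R$ define $Q(f)\in[0,\infty]$ by $$Q(f)=\big(f(q_1)-f(p_\emptyset)\big)^2+\sum_{w\in\tilde W_*}\Big(\frac{15}{7}\Big)^{|w|}\Big(\big(f(p_w)-f(p_{w0})\big)^2+\big(f(p_w)-f(p_{w3})\big)^2\Big).$$ **Theorem 2.3.** There are constants $C_1,C_2>0$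 such that for every continuous $f:\partial\Omega\to\mathbb R$ and every continuous function $u:\bar\Omega\to\mathbb R$ that is harmonic in $\Omega$ and satisfies $u|_{\partial\Omega}=f$, $$C_1\,Q(f)\le\mathcal E(u)\le C_2\,Q(f),$$ where both sides may be infinite. -/

import Mathlib

open Set

noncomputable section

namespace SG3

/-- The Euclidean plane. -/
abbrev Plane : Type := EuclideanSpace ℝ (Fin 2)

/-- The vertices `q₀` (top), `q₁` (bottom left), `q₂` (bottom right) of an equilateral triangle. -/
def q : Fin 3 → Plane :=
  ![!₂[1 / Real.sqrt 3, 1], !₂[0, 0], !₂[2 / Real.sqrt 3, 0]]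

/-- The translation parts of the six contractions, multiplied by three. -/
def shift : Fin 6 → Plane :=
  ![q 0 + q 0, q 1 + q 1, q 2 + q 2, q 1 + q 2, q 0 + q 2, q 0 + q 1]

/-- The six contractions: `F i z = z/3 + (2/3) q_i` for `i = 0, 1, 2` (so that `q_i` is fixed), and
`F 3 z = z/3 + (q₁ + q₂)/3`, `F 4 z = z/3 + (q₀ + q₂)/3`, `F 5 z = z/3 + (q₀ + q₁)/3`. -/
def F (i : Fin 6) (z : Plane) : Plane := (1 / 3 : ℝ) • z + (1 / 3 : ℝ) • shift i

/-- `F_w = F_{w₁} ∘ ⋯ ∘ F_{w_m}` for a word `w = w₁ ⋯ w_m`; the identity for the empty word. -/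
def Fw (w : List (Fin 6)) : Plane → Plane := w.foldr (fun i g => F i ∘ g) id

/-- The vertex sets: `V_0 = {q₀, q₁, q₂}` and `V_{m+1} = ⋃ i, F_i V_m`. -/
def V : ℕ → Set Plane
  | 0 => range q
  | m + 1 => ⋃ i, F i '' V m

/-- The level-3 Sierpinski gasket, as the closure of `V_* = ⋃ m, V_m`. It is the unique nonempty
compact set `K` with `K = ⋃ i, F_i K`: see `isAttractor_gasket` and `eq_gasket` below. -/
def gasket : Set Plane := closure (⋃ m, V m)

/-- The edge relation `x ∼_m y` of the graph `Γ_m`: `x` and `y` are two different vertices of a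
common `m`-cell. -/
def Adj (m : ℕ) (x y : Plane) : Prop :=
  x ≠ y ∧ ∃ w : List (Fin 6), w.length = m ∧ x ∈ Fw w '' V 0 ∧ y ∈ Fw w '' V 0

/-- The left half domain `Ω`: the part of the gasket, without `V_0`, that lies strictly to the left
of the vertical symmetry line (the vertical line through `q₀`). -/
def halfDomain : Set Plane := {x | x ∈ gasket ∧ x ∉ V 0 ∧ x 0 < (q 0) 0}

/-- The Cantor set `X` in which the vertical symmetry line meets the gasket. -/
def cutSet : Set Plane := {x | x ∈ gasket ∧ x 0 = (q 0) 0}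

/-- The boundary `∂Ω = {q₁} ∪ X` of the half domain. -/
def halfBoundary : Set Plane := {q 1} ∪ cutSet

/-- The closed half domain `Ω ∪ ∂Ω`. -/
def closedHalf : Set Plane := halfDomain ∪ halfBoundary

/-- `u` is harmonic in `Ω`: at every vertex `x ∈ V_m ∩ Ω` all of whose `m`-cells are contained in
`Ω ∪ ∂Ω`, the sum of `u x - u y` over the neighbours `y` of `x` in `Γ_m` vanishes. Every vertex in
`Ω` satisfies this condition on the cells for all large `m`. The neighbours are finite in number
(`finite_adj` below). -/
def HarmonicInHalf (u : Plane → ℝ) : Prop :=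
  ∀ (m : ℕ) (x : Plane), x ∈ V m → x ∈ halfDomain →
    (∀ w : List (Fin 6), w.length = m → x ∈ Fw w '' V 0 → Fw w '' gasket ⊆ closedHalf) →
    ∑ᶠ (y : Plane) (_ : Adj m x y), (u x - u y) = 0

/-- `u` solves the Dirichlet problem `Δu = 0` in `Ω`, `u = f` on `∂Ω`, and is continuous on
`Ω ∪ ∂Ω`. Only the values of `f` on `∂Ω` and those of `u` on `Ω ∪ ∂Ω` matter. -/
structure IsDirichletSolution (f u : Plane → ℝ) : Prop where
  continuousOn : ContinuousOn u closedHalf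
  boundary : ∀ x ∈ halfBoundary, u x = f x
  harmonic : HarmonicInHalf u

/-- The unrenormalized energy of `u` on the three edges of the cell with word `w`. -/
def cellEnergy (u : Plane → ℝ) (w : List (Fin 6)) : ℝ :=
  (u (Fw w (q 0)) - u (Fw w (q 1))) ^ 2 + (u (Fw w (q 1)) - u (Fw w (q 2))) ^ 2 +
    (u (Fw w (q 2)) - u (Fw w (q 0))) ^ 2

/-- The level-`m` graph energy of `u` on the half domain, with renormalization factor `r = 7/15`:
the sum of `r⁻ᵐ (u x - u y)²` over the edges of the `m`-cells contained in `Ω ∪ ∂Ω`. -/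
def halfGraphEnergy (m : ℕ) (u : Plane → ℝ) : ENNReal :=
  ∑' w : {w : List (Fin 6) // w.length = m ∧ Fw w '' gasket ⊆ closedHalf},
    ENNReal.ofReal ((15 / 7 : ℝ) ^ m * cellEnergy u w.1)

/-- The energy of `u` on the half domain, possibly infinite. The graph energies increase with the
level, so that their limit is their supremum. -/
def halfEnergy (u : Plane → ℝ) : ENNReal := ⨆ m : ℕ, halfGraphEnergy m u

/-- The points `p_w = F_w p_∅` with `p_∅ = F_3 q₀`. -/
def p (w : List (Fin 6)) : Plane := Fw w (F 3 (q 0))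

/-- `Q(f) = (f(q₁) - f(p_∅))² + ∑_w (15/7)^|w| ((f(p_w) - f(p_{w0}))² + (f(p_w) - f(p_{w3}))²)`,
possibly infinite, where `w` runs through all finite words in the letters `0` and `3`. -/
def Q (f : Plane → ℝ) : ENNReal :=
  ENNReal.ofReal ((f (q 1) - f (p [])) ^ 2) +
    ∑' w : {w : List (Fin 6) // ∀ i ∈ w, i = 0 ∨ i = 3},
      ENNReal.ofReal ((15 / 7 : ℝ) ^ w.1.length *
        ((f (p w.1) - f (p (w.1 ++ [0]))) ^ 2 + (f (p w.1) - f (p (w.1 ++ [3]))) ^ 2))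

/-! Sanity facts about the definitions. -/

theorem finite_adj (m : ℕ) (x : Plane) : {y | Adj m x y}.Finite := by
  have h : (⋃ w ∈ {w : List (Fin 6) | w.length = m}, Fw w '' V 0).Finite := by
    refine Set.Finite.biUnion (List.finite_length_eq (Fin 6) m) fun w _ => ?_
    exact (Set.finite_range q).image _
  refine h.subset ?_
  rintro y ⟨_, w, hw, _, hy⟩
  exact Set.mem_biUnion (show w ∈ {w : List (Fin 6) | w.length = m} from hw) hy

theorem F_sub (i : Fin 6) (a b : Plane) : F i a - F i b = (1 / 3 : ℝ) • (a - b) := by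
  simp only [F, smul_sub]; abel

theorem dist_F (i : Fin 6) (a b : Plane) : dist (F i a) (F i b) = 1 / 3 * dist a b := by
  rw [dist_eq_norm, F_sub, norm_smul, dist_eq_norm]; norm_num

theorem continuous_F (i : Fin 6) : Continuous (F i) := by
  unfold F; fun_prop

theorem F_fix (j : Fin 3) : ∃ i : Fin 6, F i (q j) = q j := by
  have key : ∀ z : Plane, (1 / 3 : ℝ) • z + (1 / 3 : ℝ) • (z + z) = z := fun z => by module
  fin_cases j
  · exact ⟨0, key _⟩
  · exact ⟨1, key _⟩
  · exact ⟨2, key _⟩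

theorem bounded_vertices : Bornology.IsBounded (⋃ m, V m) := by
  obtain ⟨R, hR⟩ := (Set.finite_range q).isBounded.exists_norm_le
  have hq : ∀ j, ‖q j‖ ≤ R := fun j => hR _ ⟨j, rfl⟩
  have hs : ∀ i, ‖shift i‖ ≤ 2 * R := by
    have h2 : ∀ j k, ‖q j + q k‖ ≤ 2 * R := fun j k =>
      (norm_add_le _ _).trans (by linarith [hq j, hq k])
    intro i
    fin_cases i
    exacts [h2 0 0, h2 1 1, h2 2 2, h2 1 2, h2 0 2, h2 0 1]
  refine isBounded_iff_forall_norm_le.2 ⟨R, fun x hx => ?_⟩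
  obtain ⟨m, hm⟩ := Set.mem_iUnion.1 hx
  clear hx
  induction m generalizing x with
  | zero => exact hR x hm
  | succ m ih =>
    obtain ⟨i, z, hz, rfl⟩ := Set.mem_iUnion.1 hm
    have h1 := norm_add_le ((1 / 3 : ℝ) • z) ((1 / 3 : ℝ) • shift i)
    rw [norm_smul, norm_smul] at h1
    norm_num at h1
    have h2 := ih z hz
    have h3 := hs i
    simp only [F]
    norm_num
    linarith

theorem V_subset_succ (m : ℕ) : V m ⊆ V (m + 1) := by
  induction m with
  | zero =>
    rintro _ ⟨j, rfl⟩
    obtain ⟨i, hi⟩ := F_fix j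
    exact Set.mem_iUnion.2 ⟨i, q j, ⟨j, rfl⟩, hi⟩
  | succ m ih => exact Set.iUnion_mono fun i => Set.image_mono ih

/-- The gasket is a nonempty compact set that is invariant under the contractions. -/
theorem isAttractor_gasket :
    gasket.Nonempty ∧ IsCompact gasket ∧ gasket = ⋃ i, F i '' gasket := by
  have hc : IsCompact gasket := bounded_vertices.isCompact_closure
  refine ⟨⟨q 0, subset_closure (Set.mem_iUnion.2 ⟨0, 0, rfl⟩)⟩, hc, ?_⟩
  apply Set.Subset.antisymm
  · refine closure_minimal ?_ (isCompact_iUnion fun i => hc.image (continuous_F i)).isClosed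
    refine Set.iUnion_subset fun m => (V_subset_succ m).trans ?_
    exact Set.iUnion_mono fun i => Set.image_mono ((Set.subset_iUnion V m).trans subset_closure)
  · refine Set.iUnion_subset fun i => (image_closure_subset_closure_image (continuous_F i)).trans ?_
    refine closure_mono ?_
    rw [Set.image_iUnion]
    exact Set.iUnion_subset fun m =>
      (Set.subset_iUnion (fun i => F i '' V m) i).trans (Set.subset_iUnion V (m + 1))

/-- The gasket is the only nonempty compact set that is invariant under the contractions. -/
theorem eq_gasket (K : Set Plane) (hn : K.Nonempty) (hK : IsCompact K)
    (hF : K = ⋃ i, F i '' K) : K = gasket := by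
  have key : ∀ A B : Set Plane, A.Nonempty → B.Nonempty → IsCompact A → IsCompact B →
      A = ⋃ i, F i '' A → B = ⋃ i, F i '' B → A ⊆ B := by
    intro A B hA hB hAc hBc hAF hBF
    obtain ⟨a, ha, hmax⟩ := hAc.exists_isMaxOn hA (Metric.continuous_infDist_pt B).continuousOn
    rw [hAF] at ha
    obtain ⟨i, y, hy, hya⟩ := Set.mem_iUnion.1 ha
    obtain ⟨b, hb, hyb⟩ := hBc.exists_infDist_eq_dist hB y
    have hFb : F i b ∈ B := by rw [hBF]; exact Set.mem_iUnion.2 ⟨i, b, hb, rfl⟩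
    have h1 : Metric.infDist a B ≤ 1 / 3 * Metric.infDist y B := by
      rw [← hya, hyb, ← dist_F i]
      exact Metric.infDist_le_dist_of_mem hFb
    have h2 : Metric.infDist y B ≤ Metric.infDist a B := hmax hy
    have h3 : Metric.infDist a B ≤ 0 := by linarith [Metric.infDist_nonneg (x := y) (s := B)]
    intro x hx
    have h4 : Metric.infDist x B ≤ Metric.infDist a B := hmax hx
    exact (hBc.isClosed.mem_iff_infDist_zero hB).2
      (le_antisymm (h4.trans h3) Metric.infDist_nonneg)
  obtain ⟨gn, gc, gF⟩ := isAttractor_gasket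
  exact Set.Subset.antisymm (key _ _ hn gn hK gc hF gF) (key _ _ gn hn gc hK gF hF)

end SG3

end

/-!
The symmetry line cuts the half domain into a tree of full cells: for each word `w` in the letters
`0` and `3`, the cells `w1` and `w5` lie in `Ω ∪ ∂Ω`, and every cell of the half domain lies in
exactly one of them. They meet only in the corners `v_w = F_w q₁` and `b_w = F_w F_1 q₀`, and they
touch the symmetry line only in the points `p_w`. Refinement does not decrease the energy of a cell,
and preserves it for harmonic functions, because of the explicit harmonic extension rule
(`CellHarmonic.values`, `tri_le_subEnergy`, `CellHarmonic.subEnergy_eq_tri`). So the energy of any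
`u` is at least the energy of its values on the resistance network formed by the points `v_w`,
`b_w`, `p_w`, with equality for harmonic `u` (`netForm_le_axisEnergy`, `axisEnergy_eq_netForm`), and
the values of a harmonic `u` are harmonic on the network (`HarmonicInHalf.toNet_harmonic`).

Lower bound: consecutive boundary points `p_w` and `p_{w0}`, `p_{w3}` are joined in the network by
paths of bounded length at comparable scale, so that `Q` is bounded by the network energy
(`bdrySum_le_netForm`). This holds without harmonicity.

Upper bound: the boundary values extend to the network with energy at most a multiple of `Q`, by
giving `v_w` and `b_w` the value of `p_w` (`netForm_extend_le`). It remains to compare `u` with this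
extension `g`. The difference `h = u - g` vanishes on the boundary, and by continuity of `u` it
tends to zero along the tree, but `h` need not be an admissible test function. Its soft thresholding
`φ_ε h` is, as it has finite support; hence `E(u, φ_ε h) = 0`, and
`E(φ_ε h) ≤ E(h, φ_ε h) = -E(g, φ_ε h)`, since `φ_ε` is increasing and `1`-Lipschitz. Therefore
`E(φ_ε h) ≤ E(g)`, and letting `ε` tend to zero gives `E(h) ≤ E(g)` and `E(u) ≤ 4 E(g)`
(`netForm_le_of_harmonic`). Neither uniqueness of `u` nor finiteness of its energy is needed.
-/

noncomputable section

namespace SG3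

/-! ### Barycentric coordinates -/

/-- The barycentric coordinate of a point with respect to `q₀`. -/
def bary0 (z : Plane) : ℝ := z 1

/-- The barycentric coordinate of a point with respect to `q₂`. Since `q₁` is the origin, `bary0`
and `bary2` are the linear coordinates in the basis `q₀, q₂`. -/
def bary2 (z : Plane) : ℝ := (Real.sqrt 3 * z 0 - z 1) / 2

/-- The coordinates of the vertices `q j` in the basis `q₀, q₂`. -/
def vert : Fin 3 → ℕ × ℕ := ![(1, 0), (0, 0), (0, 1)]

/-- The coordinates of the vectors `shift i` in the basis `q₀, q₂`. -/
def digit : Fin 6 → ℕ × ℕ := ![(2, 0), (0, 0), (0, 2), (0, 1), (1, 1), (1, 0)]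

theorem bary0_q (j : Fin 3) : bary0 (q j) = (vert j).1 := by
  fin_cases j <;> simp [bary0, q, vert]

theorem bary2_q (j : Fin 3) : bary2 (q j) = (vert j).2 := by
  have h : Real.sqrt 3 ≠ 0 := by positivity
  fin_cases j <;> simp [bary2, q, vert, h]; field_simp

theorem bary0_smul_add (a b : ℝ) (x y : Plane) :
    bary0 (a • x + b • y) = a * bary0 x + b * bary0 y := by
  simp [bary0]

theorem bary2_smul_add (a b : ℝ) (x y : Plane) :
    bary2 (a • x + b • y) = a * bary2 x + b * bary2 y := by
  simp [bary2]; ring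

theorem bary0_add (x y : Plane) : bary0 (x + y) = bary0 x + bary0 y := by
  simp [bary0]

theorem bary2_add (x y : Plane) : bary2 (x + y) = bary2 x + bary2 y := by
  simp [bary2]; ring

theorem bary0_shift (i : Fin 6) : bary0 (shift i) = (digit i).1 := by
  fin_cases i <;> simp [shift, bary0_add, bary0_q, vert, digit]; norm_num

theorem bary2_shift (i : Fin 6) : bary2 (shift i) = (digit i).2 := by
  fin_cases i <;> simp [shift, bary2_add, bary2_q, vert, digit]; norm_num

theorem bary0_F (i : Fin 6) (z : Plane) : bary0 (F i z) = (bary0 z + (digit i).1) / 3 := by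
  rw [F, bary0_smul_add, bary0_shift]; ring

theorem bary2_F (i : Fin 6) (z : Plane) : bary2 (F i z) = (bary2 z + (digit i).2) / 3 := by
  rw [F, bary2_smul_add, bary2_shift]; ring

theorem ext_bary {x y : Plane} (h0 : bary0 x = bary0 y) (h2 : bary2 x = bary2 y) : x = y := by
  have h : Real.sqrt 3 ≠ 0 := by positivity
  unfold bary2 at h2
  unfold bary0 at h0
  ext i
  fin_cases i
  · have : Real.sqrt 3 * x 0 = Real.sqrt 3 * y 0 := by linarith
    exact mul_left_cancel₀ h this
  · exact h0

theorem continuous_bary0 : Continuous bary0 := by unfold bary0; fun_prop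

theorem continuous_bary2 : Continuous bary2 := by unfold bary2; fun_prop

/-- The signed distance to the symmetry line, normalized to be `1` at `q₁` and `-1` at `q₂`: the
difference of the barycentric coordinates with respect to `q₁` and `q₂`. -/
def leftness (z : Plane) : ℝ := 1 - bary0 z - 2 * bary2 z

theorem leftness_F (i : Fin 6) (z : Plane) :
    leftness (F i z) = (leftness z + 2 - (digit i).1 - 2 * (digit i).2) / 3 := by
  simp only [leftness, bary0_F, bary2_F]; ring

theorem continuous_leftness : Continuous leftness :=
  (continuous_const.sub continuous_bary0).sub (continuous_const.mul continuous_bary2)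

/-! ### The gasket inside the triangle -/

/-- The closed triangle with the vertices `q₀, q₁, q₂`. -/
def triangle : Set Plane := {z | 0 ≤ bary0 z ∧ 0 ≤ bary2 z ∧ bary0 z + bary2 z ≤ 1}

theorem q_mem_triangle (j : Fin 3) : q j ∈ triangle := by
  simp only [triangle, mem_ofPred_eq, bary0_q, bary2_q]
  fin_cases j <;> simp [vert]

theorem F_mem_triangle (i : Fin 6) {z : Plane} (hz : z ∈ triangle) : F i z ∈ triangle := by
  obtain ⟨h0, h2, h⟩ := hz
  simp only [triangle, mem_ofPred_eq, bary0_F, bary2_F]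
  fin_cases i <;> simp [digit] <;> refine ⟨?_, ?_, ?_⟩ <;> linarith

theorem V_subset_triangle (m : ℕ) : V m ⊆ triangle := by
  induction m with
  | zero => rintro _ ⟨j, rfl⟩; exact q_mem_triangle j
  | succ m ih =>
    refine iUnion_subset fun i => ?_
    rintro _ ⟨z, hz, rfl⟩
    exact F_mem_triangle i (ih hz)

theorem isClosed_triangle : IsClosed triangle :=
  (isClosed_le continuous_const continuous_bary0).inter
    ((isClosed_le continuous_const continuous_bary2).inter
      (isClosed_le (continuous_bary0.add continuous_bary2) continuous_const))

theorem gasket_subset_triangle : gasket ⊆ triangle :=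
  closure_minimal (iUnion_subset V_subset_triangle) isClosed_triangle

theorem V_subset_gasket (m : ℕ) : V m ⊆ gasket :=
  (subset_iUnion V m).trans subset_closure

theorem q_mem_gasket (j : Fin 3) : q j ∈ gasket := V_subset_gasket 0 ⟨j, rfl⟩

theorem F_mem_gasket (i : Fin 6) {z : Plane} (hz : z ∈ gasket) : F i z ∈ gasket := by
  rw [isAttractor_gasket.2.2]
  exact mem_iUnion.2 ⟨i, z, hz, rfl⟩

theorem Fw_cons (i : Fin 6) (w : List (Fin 6)) (z : Plane) : Fw (i :: w) z = F i (Fw w z) := rfl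

theorem Fw_append (w γ : List (Fin 6)) (z : Plane) : Fw (w ++ γ) z = Fw w (Fw γ z) := by
  induction w with
  | nil => rfl
  | cons i w ih => rw [List.cons_append, Fw_cons, Fw_cons, ih]

theorem Fw_mem_gasket (w : List (Fin 6)) {z : Plane} (hz : z ∈ gasket) : Fw w z ∈ gasket := by
  induction w with
  | nil => exact hz
  | cons i w ih => exact F_mem_gasket i ih

theorem Fw_mem_triangle (w : List (Fin 6)) {z : Plane} (hz : z ∈ triangle) :
    Fw w z ∈ triangle := by
  induction w with
  | nil => exact hz
  | cons i w ih => exact F_mem_triangle i ih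

theorem F_injective (i : Fin 6) : Function.Injective (F i) := by
  intro a b h
  have := dist_F i a b
  rw [h, dist_self] at this
  exact dist_eq_zero.1 (by linarith)

theorem Fw_injective (w : List (Fin 6)) : Function.Injective (Fw w) := by
  induction w with
  | nil => exact Function.injective_id
  | cons i w ih => exact (F_injective i).comp ih

theorem dist_Fw (w : List (Fin 6)) (a b : Plane) :
    dist (Fw w a) (Fw w b) = (1 / 3) ^ w.length * dist a b := by
  induction w with
  | nil => simp [Fw]
  | cons i w ih => rw [Fw_cons, Fw_cons, dist_F, ih, List.length_cons]; ring

theorem Fw_mem_V (w : List (Fin 6)) {n : ℕ} {z : Plane} (hz : z ∈ V n) :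
    Fw w z ∈ V (w.length + n) := by
  induction w with
  | nil => simpa [Fw] using hz
  | cons i w ih =>
    rw [List.length_cons, Nat.add_right_comm]
    exact mem_iUnion.2 ⟨i, _, ih, rfl⟩

/-! ### Addresses of vertices -/

/-- Two different cells of the first level meet in vertices only. -/
theorem eq_or_mem_of_F_eq {i i' : Fin 6} {z z' : Plane} (hz : z ∈ triangle) (hz' : z' ∈ triangle)
    (h : F i z = F i' z') : i = i' ∨ z ∈ V 0 := by
  have h0 := congrArg bary0 h
  have h2 := congrArg bary2 h
  rw [bary0_F, bary0_F] at h0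
  rw [bary2_F, bary2_F] at h2
  obtain ⟨a1, a2, a3⟩ := hz
  obtain ⟨b1, b2, b3⟩ := hz'
  have key : ∀ j, bary0 z = (vert j).1 → bary2 z = (vert j).2 → z ∈ V 0 := fun j k0 k2 =>
    ⟨j, (ext_bary (k0.trans (bary0_q j).symm) (k2.trans (bary2_q j).symm)).symm⟩
  have k0 := key 0
  have k1 := key 1
  have k2 := key 2
  simp only [vert, Matrix.cons_val, Nat.cast_one, Nat.cast_zero] at k0 k1 k2
  -- The barycentric coordinates of `z` and `z'` differ by integers, not all of them zero, so that
  -- one coordinate of `z` exceeds that of `z'` by `1` and hence equals `1`.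
  fin_cases i <;> fin_cases i' <;>
    simp only [digit, Fin.zero_eta, Fin.mk_one, Fin.reduceFinMk, Matrix.cons_val, Nat.cast_ofNat,
      Nat.cast_one, Nat.cast_zero] at h0 h2 <;>
    first
    | exact Or.inl rfl
    | exact Or.inr (k0 (by linarith) (by linarith))
    | exact Or.inr (k1 (by linarith) (by linarith))
    | exact Or.inr (k2 (by linarith) (by linarith))

/-- The corners of the big triangle are corners of each cell that contains them. -/
theorem mem_V_zero_of_Fw_mem {w : List (Fin 6)} {z : Plane} (hz : z ∈ triangle)
    (h : Fw w z ∈ V 0) : z ∈ V 0 := by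
  induction w with
  | nil => exact h
  | cons i w ih =>
    obtain ⟨j, hj⟩ := h
    obtain ⟨i', hi'⟩ := F_fix j
    rw [Fw_cons, ← hi'] at hj
    rcases eq_or_mem_of_F_eq (Fw_mem_triangle w hz) (q_mem_triangle j) hj.symm with h | h
    · subst h
      exact ih ⟨j, F_injective _ hj⟩
    · exact ih h

/-- A vertex inside the cell `w` that is not a corner of it lies in subcells of `w` only. -/
theorem exists_append_of_mem_cell {w β : List (Fin 6)} {n : ℕ} {y : Plane} (hy : y ∈ triangle)
    (hy0 : y ∉ V 0) (hβ : β.length = w.length + n) (h : Fw w y ∈ Fw β '' V 0) :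
    ∃ γ : List (Fin 6), β = w ++ γ ∧ γ.length = n ∧ y ∈ Fw γ '' V 0 := by
  induction w generalizing β with
  | nil => exact ⟨β, rfl, by simpa using hβ, h⟩
  | cons i w ih =>
    cases β with
    | nil => simp at hβ; omega
    | cons i' β =>
      obtain ⟨x, hx, hxy⟩ := h
      rw [Fw_cons, Fw_cons] at hxy
      rcases eq_or_mem_of_F_eq (Fw_mem_triangle w hy)
        (Fw_mem_triangle β (V_subset_triangle 0 hx)) hxy.symm with h | h
      · subst h
        obtain ⟨γ, h1, h2, h3⟩ := ih (by simp at hβ; omega) ⟨x, hx, F_injective _ hxy⟩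
        exact ⟨γ, by rw [h1, List.cons_append], h2, h3⟩
      · exact absurd (mem_V_zero_of_Fw_mem hy h) hy0

/-- The neighbours of a vertex inside the cell `w` are the images of its neighbours in `V n`. -/
theorem setOf_adj_Fw {w : List (Fin 6)} {n : ℕ} {y : Plane} (hy : y ∈ triangle)
    (hy0 : y ∉ V 0) : {x | Adj (w.length + n) (Fw w y) x} = Fw w '' {z | Adj n y z} := by
  ext x
  constructor
  · rintro ⟨hne, β, hβ, hy', hx⟩
    obtain ⟨γ, rfl, hγ, hyγ⟩ := exists_append_of_mem_cell hy hy0 hβ hy'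
    obtain ⟨a, ha, rfl⟩ := hx
    rw [Fw_append] at hne ⊢
    exact ⟨_, ⟨fun h => hne (by rw [h]), γ, hγ, hyγ, a, ha, rfl⟩, rfl⟩
  · rintro ⟨z, ⟨hne, γ, hγ, ⟨a, ha, rfl⟩, b, hb, rfl⟩, rfl⟩
    refine ⟨fun h => hne (Fw_injective w h), w ++ γ, by simp [hγ], ⟨a, ha, ?_⟩, b, hb, ?_⟩ <;>
      rw [Fw_append]

/-! ### The closed half domain and its cells -/

theorem leftness_eq (z : Plane) : leftness z = Real.sqrt 3 * ((q 0) 0 - z 0) := by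
  have h : 0 < Real.sqrt 3 := by positivity
  simp only [leftness, bary0, bary2, q]
  simp
  field_simp
  ring

theorem leftness_pos_iff (z : Plane) : z 0 < (q 0) 0 ↔ 0 < leftness z := by
  rw [leftness_eq, mul_pos_iff_of_pos_left (by positivity), sub_pos]

theorem leftness_eq_zero_iff (z : Plane) : z 0 = (q 0) 0 ↔ leftness z = 0 := by
  have h : Real.sqrt 3 ≠ 0 := by positivity
  rw [leftness_eq, mul_eq_zero_iff_left h, sub_eq_zero, eq_comm]

theorem leftness_q (j : Fin 3) : leftness (q j) = ![0, 1, -1] j := by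
  rw [leftness, bary0_q, bary2_q]
  fin_cases j <;> simp [vert]; norm_num

theorem mem_closedHalf_iff {z : Plane} : z ∈ closedHalf ↔ z ∈ gasket ∧ 0 ≤ leftness z := by
  constructor
  · rintro (⟨h1, _, h3⟩ | h | ⟨h1, h2⟩)
    · exact ⟨h1, ((leftness_pos_iff z).1 h3).le⟩
    · rw [mem_singleton_iff] at h
      subst h
      exact ⟨q_mem_gasket 1, by rw [leftness_q]; simp⟩
    · exact ⟨h1, ((leftness_eq_zero_iff z).1 h2).ge⟩
  · rintro ⟨h1, h2⟩
    rcases h2.eq_or_lt with h | h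
    · exact Or.inr (Or.inr ⟨h1, (leftness_eq_zero_iff z).2 h.symm⟩)
    · by_cases hz : z ∈ V 0
      · obtain ⟨j, rfl⟩ := hz
        rw [leftness_q] at h
        fin_cases j
        · simp at h
        · exact Or.inr (Or.inl rfl)
        · norm_num at h
      · exact Or.inl ⟨h1, hz, (leftness_pos_iff z).2 h⟩

theorem isCompact_closedHalf : IsCompact closedHalf := by
  have : closedHalf = gasket ∩ {z | 0 ≤ leftness z} := by
    ext z; exact mem_closedHalf_iff
  rw [this]
  exact isAttractor_gasket.2.1.inter_right (isClosed_le continuous_const continuous_leftness)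

theorem leftness_mem_Icc {z : Plane} (hz : z ∈ triangle) : leftness z ∈ Icc (-1) 1 := by
  obtain ⟨h1, h2, h3⟩ := hz
  constructor <;> simp only [leftness] <;> linarith

/-- The cell `w` is contained in the closed half domain. -/
def InHalf (w : List (Fin 6)) : Prop := Fw w '' gasket ⊆ closedHalf

theorem inHalf_iff {w : List (Fin 6)} : InHalf w ↔ ∀ z ∈ gasket, 0 ≤ leftness (Fw w z) := by
  constructor
  · intro h z hz
    exact (mem_closedHalf_iff.1 (h ⟨z, hz, rfl⟩)).2
  · rintro h _ ⟨z, hz, rfl⟩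
    exact mem_closedHalf_iff.2 ⟨Fw_mem_gasket w hz, h z hz⟩

theorem not_inHalf_nil : ¬ InHalf [] := by
  intro h
  have := inHalf_iff.1 h (q 2) (q_mem_gasket 2)
  simp [Fw, leftness_q] at this
  norm_num at this

theorem inHalf_one (w : List (Fin 6)) : InHalf (1 :: w) := by
  refine inHalf_iff.2 fun z hz => ?_
  have := (leftness_mem_Icc (Fw_mem_triangle w (gasket_subset_triangle hz))).1
  rw [Fw_cons, leftness_F]
  simp [digit]; linarith

theorem inHalf_five (w : List (Fin 6)) : InHalf (5 :: w) := by
  refine inHalf_iff.2 fun z hz => ?_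
  have := (leftness_mem_Icc (Fw_mem_triangle w (gasket_subset_triangle hz))).1
  rw [Fw_cons, leftness_F]
  simp [digit]; linarith

theorem leftness_F_of_axis {i : Fin 6} (hi : i = 0 ∨ i = 3) (z : Plane) :
    leftness (F i z) = leftness z / 3 := by
  rw [leftness_F]
  rcases hi with rfl | rfl <;> simp [digit]

theorem inHalf_axis {i : Fin 6} (hi : i = 0 ∨ i = 3) (w : List (Fin 6)) :
    InHalf (i :: w) ↔ InHalf w := by
  simp only [inHalf_iff, Fw_cons, leftness_F_of_axis hi]
  refine forall₂_congr fun z _ => ?_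
  constructor <;> intro h <;> linarith

theorem leftness_Fw_sub (w : List (Fin 6)) (a b : Plane) :
    leftness (Fw w a) - leftness (Fw w b) = (leftness a - leftness b) / 3 ^ w.length := by
  induction w with
  | nil => simp [Fw]
  | cons i w ih =>
    rw [Fw_cons, Fw_cons, leftness_F, leftness_F, List.length_cons, pow_succ, ← div_div, ← ih]
    ring

theorem not_inHalf_two (w : List (Fin 6)) : ¬ InHalf (2 :: w) := by
  intro h
  have h1 := inHalf_iff.1 h (q 2) (q_mem_gasket 2)
  have := (leftness_mem_Icc (Fw_mem_triangle w (q_mem_triangle 2))).2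
  rw [Fw_cons, leftness_F] at h1
  simp [digit] at h1; linarith

/-- The cell `4` meets the symmetry line only in `F_4 q₁`, and no cell is reduced to that point. -/
theorem not_inHalf_four (w : List (Fin 6)) : ¬ InHalf (4 :: w) := by
  intro h
  have h1 := inHalf_iff.1 h (q 2) (q_mem_gasket 2)
  have h2 := leftness_Fw_sub w (q 2) (q 1)
  have h3 := (leftness_mem_Icc (Fw_mem_triangle w (q_mem_triangle 1))).2
  have h4 : (leftness (q 2) - leftness (q 1)) / 3 ^ w.length < 0 :=
    div_neg_of_neg_of_pos (by simp [leftness_q]) (by positivity)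
  rw [Fw_cons, leftness_F] at h1
  simp [digit] at h1; linarith

theorem mem_halfDomain {z : Plane} (h1 : z ∈ gasket) (h2 : z ∉ V 0) (h3 : 0 < leftness z) :
    z ∈ halfDomain := ⟨h1, h2, (leftness_pos_iff z).2 h3⟩

theorem InHalf.append {w : List (Fin 6)} (h : InHalf w) (γ : List (Fin 6)) :
    InHalf (w ++ γ) := by
  refine inHalf_iff.2 fun z hz => ?_
  rw [Fw_append]
  exact inHalf_iff.1 h _ (Fw_mem_gasket γ hz)

/-- A cell in the closed half domain touches the symmetry line at most in its right corner, which
is its point of least `leftness`. -/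
theorem InHalf.leftness_pos {w : List (Fin 6)} (h : InHalf w) {y : Plane} (hy : y ∈ gasket)
    (hy0 : y ∉ V 0) : 0 < leftness (Fw w y) := by
  have h1 := inHalf_iff.1 h (q 2) (q_mem_gasket 2)
  have h2 := leftness_Fw_sub w y (q 2)
  have h3 : 0 < leftness y - leftness (q 2) := by
    have h4 := gasket_subset_triangle hy
    rw [leftness_q]
    rcases (leftness_mem_Icc h4).1.eq_or_lt with h5 | h5
    · exfalso
      obtain ⟨k1, k2, k3⟩ := h4
      simp only [leftness] at h5
      refine hy0 ⟨2, ext_bary ?_ ?_⟩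
      · rw [bary0_q]; simp [vert]; linarith
      · rw [bary2_q]; simp [vert]; linarith
    · simp; linarith
  have h6 : 0 < (leftness y - leftness (q 2)) / 3 ^ w.length := div_pos h3 (by positivity)
  linarith

/-! ### The ladder network -/

/-- A function on the network formed by the corners of the cells `w1` and `w5`, where `w` runs
through the words in the letters `0` and `3`, encoded by `false` and `true`. The fields are the
values at `F_w q₁`, at `F_w F_1 q₀` and at `p_w`. The cell `w1` has the corners `b w`, `v w`,
`v (w3)` and the cell `w5` the corners `v (w0)`, `b w`, `p w`. -/
structure Net where
  v : List Bool → ℝ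
  b : List Bool → ℝ
  p : List Bool → ℝ

/-- The restriction of a function on the network to the part that starts at the word `w`. -/
def Net.sub (x : Net) (w : List Bool) : Net where
  v l := x.v (w ++ l)
  b l := x.b (w ++ l)
  p l := x.p (w ++ l)

/-- The application of a real function to all values of a function on the network. -/
def Net.map (φ : ℝ → ℝ) (x : Net) : Net where
  v l := φ (x.v l)
  b l := φ (x.b l)
  p l := φ (x.p l)

/-- The difference of two functions on the network. -/
def Net.diff (x y : Net) : Net where
  v l := x.v l - y.v l
  b l := x.b l - y.b l
  p l := x.p l - y.p l

/-- The graph energy form of a triangle. -/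
def triForm (a b c a' b' c' : ℝ) : ℝ :=
  (a - b) * (a' - b') + (b - c) * (b' - c') + (c - a) * (c' - a')

/-- The graph energy of a triangle. -/
def tri (a b c : ℝ) : ℝ := (a - b) ^ 2 + (b - c) ^ 2 + (c - a) ^ 2

theorem tri_nonneg (a b c : ℝ) : 0 ≤ tri a b c := by unfold tri; positivity

theorem triForm_self (a b c : ℝ) : triForm a b c a b c = tri a b c := by
  unfold triForm tri; ring

/-- The energy form of the two cells `1` and `5` at the root of the network. -/
def blockForm (x y : Net) : ℝ :=
  triForm (x.b []) (x.v []) (x.v [true]) (y.b []) (y.v []) (y.v [true]) +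
    triForm (x.v [false]) (x.b []) (x.p []) (y.v [false]) (y.b []) (y.p [])

/-- The renormalized energy form of the network, cut off after `m` generations. -/
def netForm : ℕ → Net → Net → ℝ
  | 0, _, _ => 0
  | m + 1, x, y => 15 / 7 * (blockForm x y + netForm m (x.sub [false]) (y.sub [false]) +
      netForm m (x.sub [true]) (y.sub [true]))

theorem blockForm_self_nonneg (x : Net) : 0 ≤ blockForm x x := by
  rw [blockForm, triForm_self, triForm_self]
  exact add_nonneg (tri_nonneg _ _ _) (tri_nonneg _ _ _)

theorem netForm_self_nonneg (m : ℕ) (x : Net) : 0 ≤ netForm m x x := by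
  induction m generalizing x with
  | zero => exact le_rfl
  | succ m ih =>
    have h1 := ih (x.sub [false])
    have h2 := ih (x.sub [true])
    have h3 := blockForm_self_nonneg x
    rw [netForm]; positivity

theorem netForm_self_mono (x : Net) : Monotone fun m => netForm m x x := by
  refine monotone_nat_of_le_succ fun m => ?_
  induction m generalizing x with
  | zero => exact netForm_self_nonneg 1 x
  | succ m ih =>
    have h1 := ih (x.sub [false])
    have h2 := ih (x.sub [true])
    rw [netForm, netForm]
    linarith

/-- The equations of a harmonic function at the three vertices `b []`, `v [0]`, `v [3]` next to
the root. The fluxes out of the children carry the additional conductance factor `15/7`. -/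
structure Net.RootHarmonic (x : Net) : Prop where
  b : 4 * x.b [] = x.v [] + x.v [true] + x.v [false] + x.p []
  left : (2 * x.v [false] - x.b [] - x.p []) +
    15 / 7 * (2 * x.v [false] - x.b [false] - x.v [false, true]) = 0
  right : (2 * x.v [true] - x.b [] - x.v []) +
    15 / 7 * (2 * x.v [true] - x.b [true] - x.v [true, true]) = 0

/-- Harmonicity of a function on the network at all vertices except for the root and the `p w`. -/
def Net.Harmonic (x : Net) : Prop := ∀ w, (x.sub w).RootHarmonic

theorem Net.Harmonic.sub {x : Net} (hx : x.Harmonic) (i : Bool) : (x.sub [i]).Harmonic := by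
  intro w
  exact hx (i :: w)

/-- Green's formula: against a test function that vanishes at the points `p w` and in
generation `m`, only the flux at the root is left. -/
theorem netForm_eq_flux (m : ℕ) {x y : Net} (hx : x.Harmonic) (hp : ∀ w, y.p w = 0)
    (hv : ∀ w, w.length = m → y.v w = 0) :
    netForm m x y = 15 / 7 * (2 * x.v [] - x.b [] - x.v [true]) * y.v [] := by
  induction m generalizing x y with
  | zero => rw [hv [] rfl, netForm, mul_zero]
  | succ m ih =>
    have h0 := ih (hx.sub false) (y := y.sub [false]) (fun w => hp _)
      (fun w hw => hv (false :: w) (by simp [hw]))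
    have h1 := ih (hx.sub true) (y := y.sub [true]) (fun w => hp _)
      (fun w hw => hv (true :: w) (by simp [hw]))
    obtain ⟨e1, e2, e3⟩ := hx []
    rw [netForm, h0, h1]
    simp only [Net.sub, List.nil_append, List.cons_append, blockForm, triForm, hp] at *
    linear_combination (15 / 7 * y.b []) * e1 + (15 / 7 * y.v [false]) * e2 +
      (15 / 7 * y.v [true]) * e3

/-! ### Soft thresholding and the energy bound for harmonic functions -/

/-- Soft thresholding: values in `[-ε, ε]` are sent to `0` and others are moved by `ε` towards
`0`. -/
def clip (ε t : ℝ) : ℝ := t - max (-ε) (min ε t)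

theorem clip_eq_zero {ε t : ℝ} (h : |t| ≤ ε) : clip ε t = 0 := by
  rw [abs_le] at h
  rw [clip, min_eq_right h.2, max_eq_right h.1, sub_self]

theorem clip_sub_sq_le (ε s t : ℝ) :
    (clip ε s - clip ε t) ^ 2 ≤ (s - t) * (clip ε s - clip ε t) := by
  wlog hst : s ≤ t generalizing s t
  · have := this t s (le_of_not_ge hst)
    linarith
  -- Soft thresholding is increasing and `1`-Lipschitz.
  have h1 : clip ε s ≤ clip ε t ∧ clip ε t - clip ε s ≤ t - s := by
    unfold clip
    constructor <;>
    rcases max_cases (-ε) (min ε s) with h | h <;> rcases max_cases (-ε) (min ε t) with h' | h' <;>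
      rcases min_cases ε s with k | k <;> rcases min_cases ε t with k' | k' <;> linarith
  nlinarith [mul_nonneg (sub_nonneg.2 h1.1) (sub_nonneg.2 h1.2)]

theorem netForm_clip_le (ε : ℝ) (m : ℕ) (x : Net) :
    netForm m (x.map (clip ε)) (x.map (clip ε)) ≤ netForm m x (x.map (clip ε)) := by
  induction m generalizing x with
  | zero => exact le_rfl
  | succ m ih =>
    have h0 := ih (x.sub [false])
    have h1 := ih (x.sub [true])
    have h2 : blockForm (x.map (clip ε)) (x.map (clip ε)) ≤ blockForm x (x.map (clip ε)) := by
      simp only [blockForm, triForm, Net.map, ← sq]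
      gcongr <;> exact clip_sub_sq_le ε _ _
    change netForm m ((x.map (clip ε)).sub [false]) ((x.map (clip ε)).sub [false]) ≤ _ at h0
    change netForm m ((x.map (clip ε)).sub [true]) ((x.map (clip ε)).sub [true]) ≤ _ at h1
    rw [netForm, netForm]
    change _ ≤ 15 / 7 * (_ + netForm m (x.sub [false]) ((x.sub [false]).map (clip ε)) +
      netForm m (x.sub [true]) ((x.sub [true]).map (clip ε)))
    linarith

theorem netForm_diff_left (m : ℕ) (x y z : Net) :
    netForm m (x.diff y) z = netForm m x z - netForm m y z := by
  induction m generalizing x y z with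
  | zero => simp [netForm]
  | succ m ih =>
    have h0 := ih (x.sub [false]) (y.sub [false]) (z.sub [false])
    have h1 := ih (x.sub [true]) (y.sub [true]) (z.sub [true])
    change netForm m ((x.diff y).sub [false]) _ = _ at h0
    change netForm m ((x.diff y).sub [true]) _ = _ at h1
    rw [netForm, netForm, netForm, h0, h1]
    simp only [blockForm, triForm, Net.diff]
    ring

theorem neg_netForm_le (m : ℕ) (x y : Net) :
    -(2 * netForm m x y) ≤ netForm m x x + netForm m y y := by
  induction m generalizing x y with
  | zero => simp [netForm]
  | succ m ih =>
    have h0 := ih (x.sub [false]) (y.sub [false])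
    have h1 := ih (x.sub [true]) (y.sub [true])
    have h2 : -(2 * blockForm x y) ≤ blockForm x x + blockForm y y := by
      have key : ∀ s t : ℝ, -(2 * (s * t)) ≤ s * s + t * t := fun s t => by
        nlinarith [sq_nonneg (s + t)]
      simp only [blockForm, triForm]
      linarith [key (x.b [] - x.v []) (y.b [] - y.v []),
        key (x.v [] - x.v [true]) (y.v [] - y.v [true]),
        key (x.v [true] - x.b []) (y.v [true] - y.b []),
        key (x.v [false] - x.b []) (y.v [false] - y.b []),
        key (x.b [] - x.p []) (y.b [] - y.p []),
        key (x.p [] - x.v [false]) (y.p [] - y.v [false])]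
    rw [netForm, netForm, netForm]
    linarith

theorem netForm_self_le_two_mul (m : ℕ) (x y : Net) :
    netForm m x x ≤ 2 * netForm m y y + 2 * netForm m (x.diff y) (x.diff y) := by
  induction m generalizing x y with
  | zero => simp [netForm]
  | succ m ih =>
    have h0 := ih (x.sub [false]) (y.sub [false])
    have h1 := ih (x.sub [true]) (y.sub [true])
    change _ ≤ _ + 2 * netForm m ((x.diff y).sub [false]) ((x.diff y).sub [false]) at h0
    change _ ≤ _ + 2 * netForm m ((x.diff y).sub [true]) ((x.diff y).sub [true]) at h1
    have h2 : blockForm x x ≤ 2 * blockForm y y + 2 * blockForm (x.diff y) (x.diff y) := by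
      have key : ∀ s t s' t' : ℝ, (s - t) * (s - t) ≤ 2 * ((s' - t') * (s' - t')) +
          2 * (((s - s') - (t - t')) * ((s - s') - (t - t'))) := fun s t s' t' => by
        nlinarith [sq_nonneg ((s - t) - 2 * (s' - t'))]
      simp only [blockForm, triForm, Net.diff]
      linarith [key (x.b []) (x.v []) (y.b []) (y.v []),
        key (x.v []) (x.v [true]) (y.v []) (y.v [true]),
        key (x.v [true]) (x.b []) (y.v [true]) (y.b []),
        key (x.v [false]) (x.b []) (y.v [false]) (y.b []),
        key (x.b []) (x.p []) (y.b []) (y.p []),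
        key (x.p []) (x.v [false]) (y.p []) (y.v [false])]
    rw [netForm, netForm, netForm]
    linarith

open Filter Topology in
theorem tendsto_netForm_clip (m : ℕ) (x : Net) :
    Tendsto (fun ε => netForm m (x.map (clip ε)) (x.map (clip ε))) (𝓝[>] 0)
      (𝓝 (netForm m x x)) := by
  have key : ∀ t : ℝ, Tendsto (fun ε => clip ε t) (𝓝[>] 0) (𝓝 t) := by
    intro t
    have h : Continuous fun ε => clip ε t := by unfold clip; fun_prop
    have h' := (h.tendsto 0).mono_left (nhdsWithin_le_nhds (s := Ioi 0))
    rwa [show clip 0 t = t by simp [clip]] at h'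
  induction m generalizing x with
  | zero => exact tendsto_const_nhds
  | succ m ih =>
    refine Tendsto.const_mul _ (Tendsto.add (Tendsto.add ?_ (ih (x.sub [false])))
      (ih (x.sub [true])))
    have e : ∀ s t : ℝ, Tendsto (fun ε => (clip ε s - clip ε t) * (clip ε s - clip ε t)) (𝓝[>] 0)
        (𝓝 ((s - t) * (s - t))) := fun s t =>
      ((key s).sub (key t)).mul ((key s).sub (key t))
    exact (((e _ _).add (e _ _)).add (e _ _)).add (((e _ _).add (e _ _)).add (e _ _))

/-- A harmonic function `x` has at most four times the energy of any function `y` with the same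
boundary values, if `x - y` tends to zero along the generations. The function `x - y` itself is no
admissible test function, but its soft thresholding is, since it has finite support. -/
theorem netForm_le_of_harmonic {x y : Net} (hx : x.Harmonic) (hp : ∀ w, x.p w = y.p w)
    (hv : x.v [] = y.v [])
    (hlim : ∀ ε > 0, ∃ M, ∀ w : List Bool, M ≤ w.length → |x.v w - y.v w| ≤ ε)
    {K : ℝ} (hK : ∀ m, netForm m y y ≤ K) (n : ℕ) : netForm n x x ≤ 4 * K := by
  have hclip : ∀ ε > 0, netForm n ((x.diff y).map (clip ε)) ((x.diff y).map (clip ε)) ≤ K := by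
    intro ε hε
    obtain ⟨M, hM⟩ := hlim ε hε
    set z := (x.diff y).map (clip ε) with hz
    have h0 : netForm (max n M) x z = 0 := by
      rw [netForm_eq_flux _ hx (y := z) (fun w => ?_) (fun w hw => ?_)]
      · simp [hz, Net.map, Net.diff, hv, clip_eq_zero, hε.le]
      · simp [hz, Net.map, Net.diff, hp, clip_eq_zero, hε.le]
      · exact clip_eq_zero (hM w (hw ▸ le_max_right n M))
    have h1 := netForm_clip_le ε (max n M) (x.diff y)
    rw [netForm_diff_left, h0] at h1
    have h2 := neg_netForm_le (max n M) y z
    have h3 := hK (max n M)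
    have h4 := netForm_self_mono z (le_max_left n M)
    simp only at h4
    linarith
  have h1 : netForm n (x.diff y) (x.diff y) ≤ K :=
    le_of_tendsto (tendsto_netForm_clip n (x.diff y))
      (Filter.eventually_of_mem self_mem_nhdsWithin hclip)
  have h2 := netForm_self_le_two_mul n x y
  linarith [hK n]

/-! ### Comparison of the network energy with the boundary form -/

/-- The sum over `w` in the definition of `Q`, restricted to words of length less than `m`. -/
def bdrySum : ℕ → (List Bool → ℝ) → ℝ
  | 0, _ => 0
  | m + 1, p => (p [] - p [false]) ^ 2 + (p [] - p [true]) ^ 2 +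
      15 / 7 * (bdrySum m (fun w => p (false :: w)) + bdrySum m (fun w => p (true :: w)))

theorem bdrySum_nonneg (m : ℕ) (p : List Bool → ℝ) : 0 ≤ bdrySum m p := by
  induction m generalizing p with
  | zero => exact le_rfl
  | succ m ih =>
    have h0 := ih (fun w => p (false :: w))
    have h1 := ih (fun w => p (true :: w))
    rw [bdrySum]; positivity

/-- The points `p_w` and `p_{w0}` are joined by the path `p_w, F_{w0} q₁, F_{w01} q₀, p_{w0}`, and
similarly for `p_{w3}`. -/
theorem bdrySum_le_netForm (m : ℕ) (x : Net) :
    (x.v [] - x.p []) ^ 2 + bdrySum m x.p ≤ 4 * netForm (m + 1) x x := by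
  have key : ∀ r s t : ℝ, (r - t) ^ 2 ≤ 2 * (r - s) ^ 2 + 2 * (s - t) ^ 2 := fun r s t => by
    nlinarith [sq_nonneg ((r - s) - (s - t))]
  induction m generalizing x with
  | zero =>
    -- In the block of the root, the path from `q₁` to `p_∅` passes through `F_1 q₀`.
    simp only [bdrySum, netForm, blockForm, triForm]
    linarith [key (x.v []) (x.b []) (x.p []), mul_self_nonneg (x.b [] - x.v []),
      mul_self_nonneg (x.v [] - x.v [true]), mul_self_nonneg (x.v [true] - x.b []),
      mul_self_nonneg (x.v [false] - x.b []), mul_self_nonneg (x.b [] - x.p []),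
      mul_self_nonneg (x.p [] - x.v [false])]
  | succ m ih =>
    have h0 := ih (x.sub [false])
    have h1 := ih (x.sub [true])
    rw [bdrySum, netForm]
    simp only [Net.sub, List.cons_append, List.nil_append] at h0 h1 ⊢
    simp only [blockForm, triForm]
    linarith [key (x.v []) (x.b []) (x.p []), key (x.p []) (x.v [false]) (x.p [false]),
      key (x.p []) (x.v [true]) (x.p [true]), key (x.p []) (x.b []) (x.v [true]),
      mul_self_nonneg (x.b [] - x.v []),
      mul_self_nonneg (x.v [] - x.v [true]), mul_self_nonneg (x.v [true] - x.b []),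
      mul_self_nonneg (x.v [false] - x.b []), mul_self_nonneg (x.b [] - x.p []),
      mul_self_nonneg (x.p [] - x.v [false]), sq_nonneg (x.v [true] - x.p [true]),
      sq_nonneg (x.v [false] - x.p [false])]

/-- The extension of boundary values into the network that is constant on the three points with
index `w`, except for the prescribed value `a` at the root. -/
def extend (a : ℝ) (p : List Bool → ℝ) : Net where
  v l := if l = [] then a else p l
  b := p
  p := p

/-- For `a = p []` all terms of the two sides agree up to a factor; the value at the root has an
influence on the first block only. -/
theorem netForm_extend_le (m : ℕ) (a : ℝ) (p : List Bool → ℝ) :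
    netForm m (extend a p) (extend a p) ≤ 45 / 7 * ((a - p []) ^ 2 + bdrySum m p) := by
  induction m generalizing a p with
  | zero => simp only [netForm, bdrySum]; positivity
  | succ m ih =>
    have hsub : ∀ i, (extend a p).sub [i] = extend (p [i]) (fun w => p (i :: w)) := by
      intro i
      simp only [Net.sub, extend, Net.mk.injEq, List.cons_append, List.nil_append, and_self,
        and_true]
      funext l
      by_cases hl : l = [] <;> simp [hl]
    have h0 := ih (p [false]) (fun w => p (false :: w))
    have h1 := ih (p [true]) (fun w => p (true :: w))
    rw [netForm, bdrySum, hsub, hsub]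
    simp only [blockForm, triForm]
    simp [extend] at h0 h1 ⊢
    nlinarith [sq_nonneg ((a - p []) - (p [] - p [true])), sq_nonneg (p [] - p [false])]

/-! ### Lattice coordinates of vertices and their neighbours -/

/-- The point with the coordinates `t / 3ⁿ` in the basis `q₀, q₂`. All points of `V n` are of this
form. -/
def pt (n : ℕ) (t : ℕ × ℕ) : Plane := (1 / 3 ^ n : ℝ) • ((t.1 : ℝ) • q 0 + (t.2 : ℝ) • q 2)

theorem bary0_pt (n : ℕ) (t : ℕ × ℕ) : bary0 (pt n t) = t.1 / 3 ^ n := by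
  have := bary0_smul_add (1 / 3 ^ n) 0 ((t.1 : ℝ) • q 0 + (t.2 : ℝ) • q 2) 0
  rw [zero_smul, add_zero, bary0_smul_add, bary0_q, bary0_q] at this
  rw [pt, this]
  simp [vert]; ring

theorem bary2_pt (n : ℕ) (t : ℕ × ℕ) : bary2 (pt n t) = t.2 / 3 ^ n := by
  have := bary2_smul_add (1 / 3 ^ n) 0 ((t.1 : ℝ) • q 0 + (t.2 : ℝ) • q 2) 0
  rw [zero_smul, add_zero, bary2_smul_add, bary2_q, bary2_q] at this
  rw [pt, this]
  simp [vert]; ring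

theorem pt_injective (n : ℕ) : Function.Injective (pt n) := by
  intro s t h
  have h0 := congrArg bary0 h
  have h2 := congrArg bary2 h
  rw [bary0_pt, bary0_pt, div_left_inj' (by positivity)] at h0
  rw [bary2_pt, bary2_pt, div_left_inj' (by positivity)] at h2
  exact Prod.ext (Nat.cast_injective h0) (Nat.cast_injective h2)

theorem q_eq_pt (n : ℕ) (j : Fin 3) : q j = pt n (3 ^ n • vert j) := by
  refine ext_bary ?_ ?_
  · rw [bary0_q, bary0_pt]; simp
  · rw [bary2_q, bary2_pt]; simp

theorem F_pt (i : Fin 6) (n : ℕ) (t : ℕ × ℕ) : F i (pt n t) = pt (n + 1) (3 ^ n • digit i + t) := by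
  refine ext_bary ?_ ?_
  · rw [bary0_F, bary0_pt, bary0_pt]; simp; field_simp; ring
  · rw [bary2_F, bary2_pt, bary2_pt]; simp; field_simp; ring

/-- The lattice coordinates of the lower left corner of the cell `w`, relative to the level of the
cell. -/
def corner : List (Fin 6) → ℕ × ℕ
  | [] => 0
  | i :: w => 3 ^ w.length • digit i + corner w

theorem Fw_q (w : List (Fin 6)) (j : Fin 3) : Fw w (q j) = pt w.length (corner w + vert j) := by
  induction w with
  | nil => simpa [Fw, corner] using q_eq_pt 0 j
  | cons i w ih => rw [Fw_cons, ih, F_pt, corner, List.length_cons, add_assoc]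

theorem F_q (i : Fin 6) (j : Fin 3) : F i (q j) = pt 1 (digit i + vert j) := by
  have h := Fw_q [i] j
  simp only [corner, List.length_nil, pow_zero, one_smul, add_zero] at h
  exact h

/-- The words of length `n`. -/
def words : ℕ → Finset (List (Fin 6))
  | 0 => {[]}
  | n + 1 => (Finset.univ ×ˢ words n).image fun s => s.1 :: s.2

theorem mem_words {n : ℕ} {w : List (Fin 6)} : w ∈ words n ↔ w.length = n := by
  induction n generalizing w with
  | zero => simp [words]
  | succ n ih =>
    cases w with
    | nil => simp [words]
    | cons i w => simp [words, ih]

/-- The lattice coordinates of the neighbours in `Γ_n` of the vertex `pt n t`. -/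
def nbrs (n : ℕ) (t : ℕ × ℕ) : Finset (ℕ × ℕ) :=
  ((words n ×ˢ (Finset.univ : Finset (Fin 3 × Fin 3))).filter fun s =>
    corner s.1 + vert s.2.1 = t ∧ corner s.1 + vert s.2.2 ≠ t).image
      fun s => corner s.1 + vert s.2.2

theorem pt_mem_cell_iff {w : List (Fin 6)} {t : ℕ × ℕ} :
    pt w.length t ∈ Fw w '' V 0 ↔ ∃ j, corner w + vert j = t := by
  constructor
  · rintro ⟨_, ⟨j, rfl⟩, h⟩
    rw [Fw_q] at h
    exact ⟨j, pt_injective _ h⟩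
  · rintro ⟨j, rfl⟩
    exact ⟨q j, ⟨j, rfl⟩, Fw_q w j⟩

theorem setOf_adj_pt (n : ℕ) (t : ℕ × ℕ) : {z | Adj n (pt n t) z} = pt n '' (nbrs n t) := by
  ext z
  simp only [nbrs, Finset.coe_image, Finset.coe_filter, mem_image, mem_ofPred_eq,
    Finset.mem_product, Finset.mem_univ, and_true, mem_words]
  constructor
  · rintro ⟨hne, w, rfl, ht, _, ⟨k, rfl⟩, rfl⟩
    obtain ⟨j, hj⟩ := pt_mem_cell_iff.1 ht
    refine ⟨_, ⟨(w, j, k), ⟨rfl, hj, fun h => hne ?_⟩, rfl⟩, (Fw_q w k).symm⟩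
    rw [Fw_q, h]
  · rintro ⟨_, ⟨⟨w, j, k⟩, ⟨rfl, hj, hk⟩, rfl⟩, rfl⟩
    exact ⟨fun h => hk (pt_injective _ h).symm, w, rfl, pt_mem_cell_iff.2 ⟨j, hj⟩,
      pt_mem_cell_iff.2 ⟨k, rfl⟩⟩

theorem pt_mem_V_zero_iff {n : ℕ} {t : ℕ × ℕ} : pt n t ∈ V 0 ↔ ∃ j, 3 ^ n • vert j = t := by
  constructor
  · rintro ⟨j, hj⟩
    rw [q_eq_pt n] at hj
    exact ⟨j, pt_injective n hj⟩
  · rintro ⟨j, rfl⟩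
    exact ⟨j, q_eq_pt n j⟩

theorem q_mem_V (j : Fin 3) : q j ∈ V 0 := ⟨j, rfl⟩

/-- The harmonicity condition of `u` at a vertex inside the cell `w`, in lattice coordinates
relative to `w`. -/
theorem HarmonicInHalf.sum_nbrs {u : Plane → ℝ} (hu : HarmonicInHalf u) {w : List (Fin 6)} {n : ℕ}
    {t : ℕ × ℕ} (ht : ∃ γ ∈ words n, ∃ j, corner γ + vert j = t)
    (ht0 : ¬ ∃ j, 3 ^ n • vert j = t) (hpos : 0 < leftness (Fw w (pt n t)))
    (hw : ∀ γ ∈ words n, (∃ j, corner γ + vert j = t) → InHalf (w ++ γ)) :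
    ∑ s ∈ nbrs n t, (u (Fw w (pt n t)) - u (Fw w (pt n s))) = 0 := by
  obtain ⟨γ, hγ, j, hj⟩ := ht
  have hγ' := mem_words.1 hγ
  subst hγ'
  have hV : pt γ.length t ∈ V γ.length := by
    have := Fw_mem_V γ (q_mem_V j)
    rwa [Fw_q, hj] at this
  have hV0 : pt γ.length t ∉ V 0 := fun h => ht0 (pt_mem_V_zero_iff.1 h)
  have hT := V_subset_triangle _ hV
  have := hu (w.length + γ.length) (Fw w (pt γ.length t)) (Fw_mem_V w hV)
    (mem_halfDomain (Fw_mem_gasket w (V_subset_gasket _ hV))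
      (fun h => hV0 (mem_V_zero_of_Fw_mem hT h)) hpos) ?_
  · change ∑ᶠ y ∈ {y | Adj (w.length + γ.length) (Fw w (pt γ.length t)) y}, _ = 0 at this
    rw [setOf_adj_Fw hT hV0, finsum_mem_image (Fw_injective w).injOn, setOf_adj_pt,
      finsum_mem_image (pt_injective _).injOn, finsum_mem_coe_finset] at this
    exact this
  · intro β hβ hx
    obtain ⟨δ, rfl, hδ, hy⟩ := exists_append_of_mem_cell hT hV0 hβ hx
    refine hw δ (mem_words.2 hδ) ?_
    rw [← hδ] at hy
    exact pt_mem_cell_iff.1 hy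

/-! ### Harmonic functions on a cell -/

/-- The harmonicity equations at the seven vertices of `V₁ \ V₀` for a function of the lattice
coordinates. -/
def CellHarmonic (x : ℕ × ℕ → ℝ) : Prop :=
  ∀ t ∈ ({(2, 0), (2, 1), (1, 0), (1, 1), (1, 2), (0, 1), (0, 2)} : Finset (ℕ × ℕ)),
    ∑ s ∈ nbrs 1 t, (x t - x s) = 0

theorem nbrs_one_two_zero : nbrs 1 (2, 0) = {(3, 0), (2, 1), (1, 0), (1, 1)} := by decide +kernel
theorem nbrs_one_two_one : nbrs 1 (2, 1) = {(3, 0), (2, 0), (1, 1), (1, 2)} := by decide +kernel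
theorem nbrs_one_one_zero : nbrs 1 (1, 0) = {(2, 0), (1, 1), (0, 0), (0, 1)} := by decide +kernel
theorem nbrs_one_one_one :
    nbrs 1 (1, 1) = {(0, 1), (0, 2), (2, 1), (1, 2), (2, 0), (1, 0)} := by decide +kernel
theorem nbrs_one_one_two : nbrs 1 (1, 2) = {(2, 1), (1, 1), (0, 2), (0, 3)} := by decide +kernel
theorem nbrs_one_zero_one : nbrs 1 (0, 1) = {(1, 0), (0, 0), (1, 1), (0, 2)} := by decide +kernel
theorem nbrs_one_zero_two : nbrs 1 (0, 2) = {(1, 1), (0, 1), (1, 2), (0, 3)} := by decide +kernel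
theorem nbrs_two_six_zero : nbrs 2 (6, 0) = {(7, 0), (6, 1), (5, 0), (5, 1)} := by decide +kernel
theorem nbrs_two_zero_three : nbrs 2 (0, 3) = {(1, 3), (0, 4), (1, 2), (0, 2)} := by decide +kernel

theorem sum_four {a b c d : ℕ × ℕ} (x : ℝ) (f : ℕ × ℕ → ℝ) (h : [a, b, c, d].Nodup) :
    ∑ s ∈ ({a, b, c, d} : Finset (ℕ × ℕ)), (x - f s) = 4 * x - f a - f b - f c - f d := by
  simp only [List.nodup_cons, List.mem_cons, List.not_mem_nil, or_false, not_or] at h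
  rw [Finset.sum_insert (by simp [h]), Finset.sum_insert (by simp [h]),
    Finset.sum_insert (by simp [h]), Finset.sum_singleton]
  ring

/-- The harmonic extension rule of the gasket. -/
theorem CellHarmonic.values {x : ℕ × ℕ → ℝ} (h : CellHarmonic x) :
    x (1, 1) = (x (3, 0) + x (0, 0) + x (0, 3)) / 3 ∧
    x (2, 0) = (8 * x (3, 0) + 4 * x (0, 0) + 3 * x (0, 3)) / 15 ∧
    x (2, 1) = (8 * x (3, 0) + 4 * x (0, 3) + 3 * x (0, 0)) / 15 ∧
    x (1, 0) = (8 * x (0, 0) + 4 * x (3, 0) + 3 * x (0, 3)) / 15 ∧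
    x (1, 2) = (8 * x (0, 3) + 4 * x (3, 0) + 3 * x (0, 0)) / 15 ∧
    x (0, 1) = (8 * x (0, 0) + 4 * x (0, 3) + 3 * x (3, 0)) / 15 ∧
    x (0, 2) = (8 * x (0, 3) + 4 * x (0, 0) + 3 * x (3, 0)) / 15 := by
  have h1 := h (2, 0) (by decide)
  have h2 := h (2, 1) (by decide)
  have h3 := h (1, 0) (by decide)
  have h4 := h (1, 1) (by decide)
  have h5 := h (1, 2) (by decide)
  have h6 := h (0, 1) (by decide)
  have h7 := h (0, 2) (by decide)
  rw [nbrs_one_two_zero, sum_four _ _ (by decide)] at h1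
  rw [nbrs_one_two_one, sum_four _ _ (by decide)] at h2
  rw [nbrs_one_one_zero, sum_four _ _ (by decide)] at h3
  rw [nbrs_one_one_one, Finset.sum_insert (by decide), Finset.sum_insert (by decide),
    sum_four _ _ (by decide)] at h4
  rw [nbrs_one_one_two, sum_four _ _ (by decide)] at h5
  rw [nbrs_one_zero_one, sum_four _ _ (by decide)] at h6
  rw [nbrs_one_zero_two, sum_four _ _ (by decide)] at h7
  refine ⟨?_, ?_, ?_, ?_, ?_, ?_, ?_⟩ <;> linarith

/-- The graph energy on the cells of the first level, as a function of the lattice coordinates. -/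
def subEnergy (x : ℕ × ℕ → ℝ) : ℝ :=
  ∑ i, tri (x (digit i + vert 0)) (x (digit i + vert 1)) (x (digit i + vert 2))

theorem subEnergy_eq (x : ℕ × ℕ → ℝ) : subEnergy x =
    tri (x (3, 0)) (x (2, 0)) (x (2, 1)) + tri (x (1, 0)) (x (0, 0)) (x (0, 1)) +
    tri (x (1, 2)) (x (0, 2)) (x (0, 3)) + tri (x (1, 1)) (x (0, 1)) (x (0, 2)) +
    tri (x (2, 1)) (x (1, 1)) (x (1, 2)) + tri (x (2, 0)) (x (1, 0)) (x (1, 1)) := by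
  simp [subEnergy, Fin.sum_univ_six, digit, vert]

/-- The renormalization identity: harmonic extension preserves the renormalized energy. -/
theorem CellHarmonic.subEnergy_eq_tri {x : ℕ × ℕ → ℝ} (h : CellHarmonic x) :
    15 / 7 * subEnergy x = tri (x (3, 0)) (x (0, 0)) (x (0, 3)) := by
  obtain ⟨h1, h2, h3, h4, h5, h6, h7⟩ := h.values
  rw [subEnergy_eq, h1, h2, h3, h4, h5, h6, h7]
  unfold tri
  ring

/-- The renormalized energy does not decrease under refinement, since the energy of any extension
of the corner values is that of the harmonic extension plus that of the difference. -/
theorem tri_le_subEnergy (x : ℕ × ℕ → ℝ) :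
    tri (x (3, 0)) (x (0, 0)) (x (0, 3)) ≤ 15 / 7 * subEnergy x := by
  rw [subEnergy_eq]
  generalize x (3, 0) = A
  generalize x (0, 0) = B
  generalize x (0, 3) = C
  generalize x (2, 0) = a
  generalize x (2, 1) = a'
  generalize x (1, 0) = b
  generalize x (0, 1) = b'
  generalize x (1, 2) = c
  generalize x (0, 2) = c'
  generalize x (1, 1) = d
  have key : 15 / 7 * (tri A a a' + tri b B b' + tri c c' C + tri d b' c' + tri a' d c +
      tri a b d) = tri A B C +
      15 / 7 * (tri 0 (a - (8 * A + 4 * B + 3 * C) / 15) (a' - (8 * A + 4 * C + 3 * B) / 15) +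
      tri (b - (8 * B + 4 * A + 3 * C) / 15) 0 (b' - (8 * B + 4 * C + 3 * A) / 15) +
      tri (c - (8 * C + 4 * A + 3 * B) / 15) (c' - (8 * C + 4 * B + 3 * A) / 15) 0 +
      tri (d - (A + B + C) / 3) (b' - (8 * B + 4 * C + 3 * A) / 15)
        (c' - (8 * C + 4 * B + 3 * A) / 15) +
      tri (a' - (8 * A + 4 * C + 3 * B) / 15) (d - (A + B + C) / 3)
        (c - (8 * C + 4 * A + 3 * B) / 15) +
      tri (a - (8 * A + 4 * B + 3 * C) / 15) (b - (8 * B + 4 * A + 3 * C) / 15)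
        (d - (A + B + C) / 3)) := by
    unfold tri; ring
  rw [key]
  refine le_add_of_nonneg_right (mul_nonneg (by norm_num) ?_)
  refine add_nonneg (add_nonneg (add_nonneg (add_nonneg (add_nonneg ?_ ?_) ?_) ?_) ?_) ?_ <;>
    exact tri_nonneg _ _ _

/-- The graph energy of `u` on the triangle `V₀`. -/
def baseEnergy (u : Plane → ℝ) : ℝ := tri (u (q 0)) (u (q 1)) (u (q 2))

theorem baseEnergy_eq (u : Plane → ℝ) :
    baseEnergy u = tri (u (pt 1 (3, 0))) (u (pt 1 (0, 0))) (u (pt 1 (0, 3))) := by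
  rw [baseEnergy, q_eq_pt 1 0, q_eq_pt 1 1, q_eq_pt 1 2]
  rfl

theorem sum_baseEnergy (u : Plane → ℝ) :
    ∑ i, baseEnergy (u ∘ F i) = subEnergy fun t => u (pt 1 t) := by
  simp only [baseEnergy, Function.comp_apply, F_q, subEnergy]

/-- Harmonicity at all vertices of the gasket except for the three corners. -/
def GasketHarmonic (u : Plane → ℝ) : Prop := ∀ γ, CellHarmonic fun t => u (Fw γ (pt 1 t))

/-- The renormalized graph energy of level `m` on the whole gasket. -/
def gasketEnergy : ℕ → (Plane → ℝ) → ℝ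
  | 0, u => baseEnergy u
  | m + 1, u => 15 / 7 * ∑ i, gasketEnergy m (u ∘ F i)

theorem baseEnergy_le_gasketEnergy (m : ℕ) (u : Plane → ℝ) :
    baseEnergy u ≤ gasketEnergy m u := by
  induction m generalizing u with
  | zero => exact le_rfl
  | succ m ih =>
    have h1 : ∑ i, baseEnergy (u ∘ F i) ≤ ∑ i, gasketEnergy m (u ∘ F i) :=
      Finset.sum_le_sum fun i _ => ih _
    have h2 := tri_le_subEnergy fun t => u (pt 1 t)
    rw [← sum_baseEnergy, ← baseEnergy_eq] at h2
    rw [gasketEnergy]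
    linarith

theorem GasketHarmonic.gasketEnergy_eq {u : Plane → ℝ} (hu : GasketHarmonic u) (m : ℕ) :
    gasketEnergy m u = baseEnergy u := by
  induction m generalizing u with
  | zero => rfl
  | succ m ih =>
    have h1 : ∑ i, gasketEnergy m (u ∘ F i) = ∑ i, baseEnergy (u ∘ F i) :=
      Finset.sum_congr rfl fun i _ => ih fun γ => hu (i :: γ)
    have h2 := (hu []).subEnergy_eq_tri
    change 15 / 7 * (subEnergy fun t => u (pt 1 t)) =
      tri (u (pt 1 _)) (u (pt 1 _)) (u (pt 1 _)) at h2
    rw [gasketEnergy, h1, sum_baseEnergy, h2, baseEnergy_eq]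

theorem baseEnergy_nonneg (u : Plane → ℝ) : 0 ≤ baseEnergy u := tri_nonneg _ _ _

theorem gasketEnergy_nonneg (m : ℕ) (u : Plane → ℝ) : 0 ≤ gasketEnergy m u :=
  (baseEnergy_nonneg u).trans (baseEnergy_le_gasketEnergy m u)

/-! ### From the half domain to the ladder network -/

/-- The letter `0` or `3` encoded by a Boolean. -/
def axisLetter (i : Bool) : Fin 6 := if i then 3 else 0

/-- The word in the letters `0` and `3` encoded by a list of Booleans. -/
def axisWord (w : List Bool) : List (Fin 6) := w.map axisLetter

theorem axisLetter_eq (i : Bool) : axisLetter i = 0 ∨ axisLetter i = 3 := by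
  cases i <;> simp [axisLetter]

theorem inHalf_axisWord_append (w : List Bool) (γ : List (Fin 6)) :
    InHalf (axisWord w ++ γ) ↔ InHalf γ := by
  induction w with
  | nil => rfl
  | cons i w ih => exact (inHalf_axis (axisLetter_eq i) _).trans ih

theorem leftness_axisWord (w : List Bool) (z : Plane) :
    leftness (Fw (axisWord w) z) = leftness z / 3 ^ w.length := by
  induction w with
  | nil => simp [axisWord, Fw]
  | cons i w ih =>
    change leftness (F (axisLetter i) (Fw (axisWord w) z)) = _
    rw [leftness_F_of_axis (axisLetter_eq i), ih, List.length_cons, pow_succ, div_div]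

/-- The values of `u` at the vertices of the network. -/
def toNet (u : Plane → ℝ) : Net where
  v w := u (Fw (axisWord w) (q 1))
  b w := u (Fw (axisWord w) (F 1 (q 0)))
  p w := u (p (axisWord w))

theorem toNet_sub (u : Plane → ℝ) (w : List Bool) :
    (toNet u).sub w = toNet (u ∘ Fw (axisWord w)) := by
  simp only [Net.sub, toNet, Function.comp_apply, p, ← Fw_append, axisWord, List.map_append]

/-- The renormalized graph energy of level `m` on the half domain. -/
def axisEnergy : ℕ → (Plane → ℝ) → ℝ
  | 0, _ => 0
  | m + 1, u => 15 / 7 * (gasketEnergy m (u ∘ F 1) + gasketEnergy m (u ∘ F 5) +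
      axisEnergy m (u ∘ F 0) + axisEnergy m (u ∘ F 3))

theorem axisEnergy_nonneg (m : ℕ) (u : Plane → ℝ) : 0 ≤ axisEnergy m u := by
  induction m generalizing u with
  | zero => exact le_rfl
  | succ m ih =>
    have h1 := gasketEnergy_nonneg m (u ∘ F 1)
    have h2 := gasketEnergy_nonneg m (u ∘ F 5)
    have h3 := ih (u ∘ F 0)
    have h4 := ih (u ∘ F 3)
    rw [axisEnergy]; positivity

theorem toNet_blockForm (u : Plane → ℝ) :
    blockForm (toNet u) (toNet u) = baseEnergy (u ∘ F 1) + baseEnergy (u ∘ F 5) := by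
  have h1 : F 1 (q 1) = q 1 := by rw [F_q, q_eq_pt 1 1]; rfl
  have h2 : F 1 (q 2) = F 3 (q 1) := by rw [F_q, F_q]; rfl
  have h3 : F 5 (q 0) = F 0 (q 1) := by rw [F_q, F_q]; rfl
  have h4 : F 5 (q 1) = F 1 (q 0) := by rw [F_q, F_q]; rfl
  have h5 : F 5 (q 2) = F 3 (q 0) := by rw [F_q, F_q]; rfl
  rw [blockForm, triForm_self, triForm_self, baseEnergy, baseEnergy]
  simp only [Function.comp_apply, h1, h2, h3, h4, h5]
  rfl

theorem netForm_le_axisEnergy (m : ℕ) (u : Plane → ℝ) :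
    netForm m (toNet u) (toNet u) ≤ axisEnergy m u := by
  induction m generalizing u with
  | zero => exact le_rfl
  | succ m ih =>
    have h1 := baseEnergy_le_gasketEnergy m (u ∘ F 1)
    have h2 := baseEnergy_le_gasketEnergy m (u ∘ F 5)
    have h3 := ih (u ∘ F 0)
    have h4 := ih (u ∘ F 3)
    rw [netForm, axisEnergy, toNet_blockForm, toNet_sub, toNet_sub]
    change 15 / 7 * (_ + netForm m (toNet (u ∘ F 0)) (toNet (u ∘ F 0)) +
      netForm m (toNet (u ∘ F 3)) (toNet (u ∘ F 3))) ≤ _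
    linarith

theorem axisEnergy_eq_netForm (m : ℕ) {u : Plane → ℝ}
    (hu : ∀ w i, i = 1 ∨ i = 5 → GasketHarmonic (u ∘ Fw (axisWord w ++ [i]))) :
    axisEnergy m u = netForm m (toNet u) (toNet u) := by
  induction m generalizing u with
  | zero => rfl
  | succ m ih =>
    have h1 := (hu [] 1 (Or.inl rfl)).gasketEnergy_eq m
    have h2 := (hu [] 5 (Or.inr rfl)).gasketEnergy_eq m
    have h3 := ih (u := u ∘ F 0) fun w i hi => hu (false :: w) i hi
    have h4 := ih (u := u ∘ F 3) fun w i hi => hu (true :: w) i hi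
    change gasketEnergy m (u ∘ F 1) = baseEnergy (u ∘ F 1) at h1
    change gasketEnergy m (u ∘ F 5) = baseEnergy (u ∘ F 5) at h2
    rw [netForm, axisEnergy, toNet_blockForm, toNet_sub, toNet_sub, h1, h2, h3, h4]
    change _ = 15 / 7 * (_ + netForm m (toNet (u ∘ F 0)) (toNet (u ∘ F 0)) +
      netForm m (toNet (u ∘ F 3)) (toNet (u ∘ F 3)))
    ring

theorem HarmonicInHalf.gasketHarmonic {u : Plane → ℝ} (hu : HarmonicInHalf u) {α : List (Fin 6)}
    (hα : InHalf α) : GasketHarmonic (u ∘ Fw α) := by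
  intro γ t ht
  have h1 : ∀ t ∈ ({(2, 0), (2, 1), (1, 0), (1, 1), (1, 2), (0, 1), (0, 2)} : Finset (ℕ × ℕ)),
      (∃ γ ∈ words 1, ∃ j, corner γ + vert j = t) ∧ ¬ ∃ j, 3 ^ 1 • vert j = t := by
    decide +kernel
  obtain ⟨ht1, ht0⟩ := h1 t ht
  have hγ := hα.append γ
  simp only [Function.comp_apply, ← Fw_append]
  refine hu.sum_nbrs ht1 ht0 (hγ.leftness_pos ?_ (fun h => ht0 (pt_mem_V_zero_iff.1 h)))
    fun δ _ _ => hγ.append δ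
  obtain ⟨δ, hδ, j, rfl⟩ := ht1
  rw [← mem_words.1 hδ, ← Fw_q]
  exact Fw_mem_gasket δ (q_mem_gasket j)

theorem HarmonicInHalf.gasketHarmonic_axis {u : Plane → ℝ} (hu : HarmonicInHalf u) (w : List Bool)
    (i : Fin 6) (hi : i = 1 ∨ i = 5) : GasketHarmonic (u ∘ Fw (axisWord w ++ [i])) := by
  refine hu.gasketHarmonic ((inHalf_axisWord_append w _).2 ?_)
  rcases hi with rfl | rfl
  exacts [inHalf_one [], inHalf_five []]

/-- The values of a harmonic function on the half domain are harmonic on the network. The equations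
at `F_{w0} q₁` and `F_{w3} q₁` come from the graph of level `|w| + 2`, and the fluxes out of `w5`
and `w1` are expressed through the corner values of these cells by the harmonic extension rule. -/
theorem HarmonicInHalf.toNet_harmonic {u : Plane → ℝ} (hu : HarmonicInHalf u) :
    (toNet u).Harmonic := by
  intro w
  rw [toNet_sub]
  have hin : ∀ γ, (∃ δ, γ = 1 :: δ) ∨ (∃ δ, γ = 5 :: δ) ∨ (∃ δ, γ = 0 :: 1 :: δ) ∨
      (∃ δ, γ = 3 :: 1 :: δ) → InHalf (axisWord w ++ γ) := by
    intro γ hγ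
    rw [inHalf_axisWord_append]
    rcases hγ with ⟨δ, rfl⟩ | ⟨δ, rfl⟩ | ⟨δ, rfl⟩ | ⟨δ, rfl⟩
    exacts [inHalf_one _, inHalf_five _, (inHalf_axis (Or.inl rfl) _).2 (inHalf_one _),
      (inHalf_axis (Or.inr rfl) _).2 (inHalf_one _)]
  -- `t.1 + 2 * t.2 < 3 ^ n` says that the point lies strictly to the left of the symmetry line.
  have hpos : ∀ (n : ℕ) (t : ℕ × ℕ), t.1 + 2 * t.2 < 3 ^ n →
      0 < leftness (Fw (axisWord w) (pt n t)) := by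
    intro n t ht
    rw [leftness_axisWord]
    refine div_pos ?_ (by positivity)
    rw [leftness, bary0_pt, bary2_pt]
    have : ((t.1 + 2 * t.2 : ℕ) : ℝ) < ((3 ^ n : ℕ) : ℝ) := by exact_mod_cast ht
    push_cast at this
    have h3 : (0 : ℝ) < 3 ^ n := by positivity
    have h4 : (1 : ℝ) - t.1 / 3 ^ n - 2 * (t.2 / 3 ^ n) = (3 ^ n - (t.1 + 2 * t.2)) / 3 ^ n := by
      field_simp
      ring
    rw [h4]
    exact div_pos (by linarith) h3
  -- The equations at `F_w F_1 q₀`, `F_{w0} q₁` and `F_{w3} q₁`, whose cells of level `|w| + 1` or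
  -- `|w| + 2` are listed.
  have eb := hu.sum_nbrs (w := axisWord w) (n := 1) (t := (1, 0)) (by decide +kernel)
    (by decide +kernel) (hpos _ _ (by norm_num)) fun γ hγ hj => hin γ <| by
      have : ∀ γ ∈ words 1, (∃ j, corner γ + vert j = (1, 0)) → γ = [1] ∨ γ = [5] := by
        decide +kernel
      rcases this γ hγ hj with rfl | rfl
      exacts [Or.inl ⟨_, rfl⟩, Or.inr (Or.inl ⟨_, rfl⟩)]
  have el := hu.sum_nbrs (w := axisWord w) (n := 2) (t := (6, 0)) (by decide +kernel)
    (by decide +kernel) (hpos _ _ (by norm_num)) fun γ hγ hj => hin γ <| by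
      have : ∀ γ ∈ words 2, (∃ j, corner γ + vert j = (6, 0)) → γ = [0, 1] ∨ γ = [5, 0] := by
        decide +kernel
      rcases this γ hγ hj with rfl | rfl
      exacts [Or.inr (Or.inr (Or.inl ⟨_, rfl⟩)), Or.inr (Or.inl ⟨_, rfl⟩)]
  have er := hu.sum_nbrs (w := axisWord w) (n := 2) (t := (0, 3)) (by decide +kernel)
    (by decide +kernel) (hpos _ _ (by norm_num)) fun γ hγ hj => hin γ <| by
      have : ∀ γ ∈ words 2, (∃ j, corner γ + vert j = (0, 3)) → γ = [3, 1] ∨ γ = [1, 2] := by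
        decide +kernel
      rcases this γ hγ hj with rfl | rfl
      exacts [Or.inr (Or.inr (Or.inr ⟨_, rfl⟩)), Or.inl ⟨_, rfl⟩]
  rw [nbrs_one_one_zero, sum_four _ (fun s => u (Fw (axisWord w) (pt 1 s))) (by decide)] at eb
  rw [nbrs_two_six_zero, sum_four _ (fun s => u (Fw (axisWord w) (pt 2 s))) (by decide)] at el
  rw [nbrs_two_zero_three, sum_four _ (fun s => u (Fw (axisWord w) (pt 2 s))) (by decide)] at er
  obtain ⟨-, f1, f2, -, -, -, -⟩ := (hu.gasketHarmonic_axis w 5 (Or.inr rfl) []).values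
  obtain ⟨-, -, -, -, g1, -, g2⟩ := (hu.gasketHarmonic_axis w 1 (Or.inl rfl) []).values
  have h5 : ∀ t, (u ∘ Fw (axisWord w ++ [5])) (Fw [] (pt 1 t)) =
      u (Fw (axisWord w) (pt 2 ((3, 0) + t))) := fun t => by
    rw [Function.comp_apply, Fw_append]
    change u (Fw (axisWord w) (F 5 (pt 1 t))) = _
    rw [F_pt]; rfl
  have h1 : ∀ t, (u ∘ Fw (axisWord w ++ [1])) (Fw [] (pt 1 t)) =
      u (Fw (axisWord w) (pt 2 t)) := fun t => by
    rw [Function.comp_apply, Fw_append]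
    change u (Fw (axisWord w) (F 1 (pt 1 t))) = _
    rw [F_pt]
    change u (Fw (axisWord w) (pt 2 (0 + t))) = _
    rw [zero_add]
  simp only [h5, Prod.mk_add_mk, Nat.reduceAdd] at f1 f2
  simp only [h1] at g1 g2
  -- All values are expressed in lattice coordinates of the second level.
  have lift : ∀ t : ℕ × ℕ, pt 1 t = pt 2 (3 • t) := fun t => by
    refine ext_bary ?_ ?_
    · rw [bary0_pt, bary0_pt]; simp; ring
    · rw [bary2_pt, bary2_pt]; simp; ring
  simp only [lift, Prod.smul_mk, smul_eq_mul, Nat.reduceMul] at eb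
  have n1 : q 1 = pt 2 (0, 0) := q_eq_pt 2 1
  have n2 : F 1 (q 0) = pt 2 (3, 0) := by rw [F_q, lift]; rfl
  have n3 : F 3 (q 0) = pt 2 (3, 3) := by rw [F_q, lift]; rfl
  have n4 : F 0 (q 1) = pt 2 (6, 0) := by rw [F_q, lift]; rfl
  have n5 : F 3 (q 1) = pt 2 (0, 3) := by rw [F_q, lift]; rfl
  have n6 : F 0 (F 1 (q 0)) = pt 2 (7, 0) := by rw [F_q, F_pt]; rfl
  have n7 : F 3 (F 1 (q 0)) = pt 2 (1, 3) := by rw [F_q, F_pt]; rfl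
  have n8 : F 0 (F 3 (q 1)) = pt 2 (6, 1) := by rw [F_q, F_pt]; rfl
  have n9 : F 3 (F 3 (q 1)) = pt 2 (0, 4) := by rw [F_q, F_pt]; rfl
  constructor
  · change 4 * u (Fw (axisWord w) (F 1 (q 0))) = u (Fw (axisWord w) (q 1)) +
      u (Fw (axisWord w) (F 3 (q 1))) + u (Fw (axisWord w) (F 0 (q 1))) +
      u (Fw (axisWord w) (F 3 (q 0)))
    rw [n2, n3, n4, n5, n1]
    linarith
  · change (2 * u (Fw (axisWord w) (F 0 (q 1))) - u (Fw (axisWord w) (F 1 (q 0))) -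
      u (Fw (axisWord w) (F 3 (q 0)))) + 15 / 7 * (2 * u (Fw (axisWord w) (F 0 (q 1))) -
      u (Fw (axisWord w) (F 0 (F 1 (q 0)))) - u (Fw (axisWord w) (F 0 (F 3 (q 1))))) = 0
    rw [n6, n8, n2, n3, n4]
    linarith
  · change (2 * u (Fw (axisWord w) (F 3 (q 1))) - u (Fw (axisWord w) (F 1 (q 0))) -
      u (Fw (axisWord w) (q 1))) + 15 / 7 * (2 * u (Fw (axisWord w) (F 3 (q 1))) -
      u (Fw (axisWord w) (F 3 (F 1 (q 0)))) - u (Fw (axisWord w) (F 3 (F 3 (q 1))))) = 0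
    rw [n7, n9, n2, n5, n1]
    linarith

/-! ### Infinite sums over words -/

theorem tsum_list {α : Type*} [Fintype α] (g : List α → ENNReal) :
    ∑' l, g l = g [] + ∑ i, ∑' l, g (i :: l) := by
  classical
  have hprod : ∑ i, ∑' l, g (i :: l) = ∑' s : α × List α, g (s.1 :: s.2) := by
    rw [ENNReal.tsum_prod (f := fun i l => g (i :: l)), tsum_fintype]
  rw [ENNReal.summable.tsum_eq_add_tsum_ite' [], hprod]
  congr 1
  have hinj : Function.Injective fun s : α × List α => s.1 :: s.2 := by
    rintro ⟨i, l⟩ ⟨j, k⟩ h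
    simpa using h
  rw [← hinj.tsum_eq]
  · simp
  · intro l hl
    cases l with
    | nil => simp at hl
    | cons i l => exact ⟨(i, l), rfl⟩

theorem cellEnergy_cons (u : Plane → ℝ) (i : Fin 6) (w : List (Fin 6)) :
    cellEnergy u (i :: w) = cellEnergy (u ∘ F i) w := rfl

theorem ofReal_scaled_cellEnergy_cons (m : ℕ) (u : Plane → ℝ) (i : Fin 6) (w : List (Fin 6)) :
    ENNReal.ofReal ((15 / 7 : ℝ) ^ (m + 1) * cellEnergy u (i :: w)) =
      ENNReal.ofReal (15 / 7) * ENNReal.ofReal ((15 / 7 : ℝ) ^ m * cellEnergy (u ∘ F i) w) := by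
  rw [← ENNReal.ofReal_mul (by norm_num), cellEnergy_cons, pow_succ']
  congr 1
  ring

/-- The recursively defined energy of the gasket is the sum over the cells of level `m`. -/
theorem tsum_indicator_gasketEnergy (m : ℕ) (u : Plane → ℝ) :
    ∑' w, {w : List (Fin 6) | w.length = m}.indicator
      (fun w => ENNReal.ofReal ((15 / 7 : ℝ) ^ m * cellEnergy u w)) w =
      ENNReal.ofReal (gasketEnergy m u) := by
  induction m generalizing u with
  | zero =>
    rw [tsum_list]
    simp [indicator, gasketEnergy, baseEnergy, tri, cellEnergy, Fw]
  | succ m ih =>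
    have h : ∀ i w, {w : List (Fin 6) | w.length = m + 1}.indicator
        (fun w => ENNReal.ofReal ((15 / 7 : ℝ) ^ (m + 1) * cellEnergy u w)) (i :: w) =
        ENNReal.ofReal (15 / 7) * {w : List (Fin 6) | w.length = m}.indicator
        (fun w => ENNReal.ofReal ((15 / 7 : ℝ) ^ m * cellEnergy (u ∘ F i) w)) w := by
      intro i w
      by_cases hw : w.length = m
      · rw [indicator_of_mem (by simpa using hw), indicator_of_mem (by simpa using hw),
          ofReal_scaled_cellEnergy_cons]
      · rw [indicator_of_notMem (by simpa using hw), indicator_of_notMem (by simpa using hw),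
          mul_zero]
    rw [tsum_list, indicator_of_notMem (by simp), zero_add, gasketEnergy,
      ENNReal.ofReal_mul (by norm_num),
      ENNReal.ofReal_sum_of_nonneg fun i _ => gasketEnergy_nonneg m _, Finset.mul_sum]
    refine Finset.sum_congr rfl fun i _ => ?_
    rw [← ih, ← ENNReal.tsum_mul_left]
    exact tsum_congr fun w => h i w

/-- The cells of level `m + 1` in the half domain are those in `1` and `5` and the images under
`F 0` and `F 3` of the cells of level `m` in the half domain. -/
theorem halfGraphEnergy_eq (m : ℕ) (u : Plane → ℝ) :
    halfGraphEnergy m u = ENNReal.ofReal (axisEnergy m u) := by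
  have hind : ∀ m u, halfGraphEnergy m u =
      ∑' w, {w : List (Fin 6) | w.length = m ∧ InHalf w}.indicator
        (fun w => ENNReal.ofReal ((15 / 7 : ℝ) ^ m * cellEnergy u w)) w := fun m u => by
    rw [← tsum_subtype]
    rfl
  induction m generalizing u with
  | zero =>
    rw [hind, axisEnergy, ENNReal.ofReal_zero, ENNReal.tsum_eq_zero]
    intro w
    refine indicator_of_notMem ?_ _
    rintro ⟨h1, h2⟩
    rw [List.length_eq_zero_iff] at h1
    exact not_inHalf_nil (h1 ▸ h2)
  | succ m ih =>
    have hnone : ∀ i, (∀ w, ¬ InHalf (i :: w)) → ∑' w,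
        {w : List (Fin 6) | w.length = m + 1 ∧ InHalf w}.indicator
        (fun w => ENNReal.ofReal ((15 / 7 : ℝ) ^ (m + 1) * cellEnergy u w)) (i :: w) = 0 :=
      fun i hi => ENNReal.tsum_eq_zero.2 fun w => indicator_of_notMem (fun h => hi w h.2) _
    have hstep : ∀ (i : Fin 6) (P : List (Fin 6) → Prop), (∀ w, InHalf (i :: w) ↔ P w) → ∑' w,
        {w : List (Fin 6) | w.length = m + 1 ∧ InHalf w}.indicator
        (fun w => ENNReal.ofReal ((15 / 7 : ℝ) ^ (m + 1) * cellEnergy u w)) (i :: w) =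
        ENNReal.ofReal (15 / 7) * ∑' w, {w : List (Fin 6) | w.length = m ∧ P w}.indicator
        (fun w => ENNReal.ofReal ((15 / 7 : ℝ) ^ m * cellEnergy (u ∘ F i) w)) w := by
      intro i P hP
      rw [← ENNReal.tsum_mul_left]
      refine tsum_congr fun w => ?_
      by_cases hw : w.length = m ∧ P w
      · rw [indicator_of_mem (by simpa [hP] using hw), indicator_of_mem (by simpa using hw),
          ofReal_scaled_cellEnergy_cons]
      · rw [indicator_of_notMem (by simpa [hP] using hw), indicator_of_notMem (by simpa using hw),
          mul_zero]
    have hfull : ∀ i : Fin 6, (∀ w, InHalf (i :: w)) → ∑' w,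
        {w : List (Fin 6) | w.length = m + 1 ∧ InHalf w}.indicator
        (fun w => ENNReal.ofReal ((15 / 7 : ℝ) ^ (m + 1) * cellEnergy u w)) (i :: w) =
        ENNReal.ofReal (15 / 7) * ENNReal.ofReal (gasketEnergy m (u ∘ F i)) := by
      intro i hi
      rw [hstep i (fun _ => True) (fun w => iff_of_true (hi w) trivial)]
      simp only [and_true]
      rw [tsum_indicator_gasketEnergy]
    have haxis : ∀ i : Fin 6, i = 0 ∨ i = 3 → ∑' w,
        {w : List (Fin 6) | w.length = m + 1 ∧ InHalf w}.indicator
        (fun w => ENNReal.ofReal ((15 / 7 : ℝ) ^ (m + 1) * cellEnergy u w)) (i :: w) =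
        ENNReal.ofReal (15 / 7) * ENNReal.ofReal (axisEnergy m (u ∘ F i)) := by
      intro i hi
      rw [hstep i InHalf (inHalf_axis hi), ← hind, ih]
    rw [hind, tsum_list, indicator_of_notMem (by simp), zero_add, Fin.sum_univ_six,
      haxis 0 (Or.inl rfl), hfull 1 inHalf_one, hnone 2 not_inHalf_two, haxis 3 (Or.inr rfl),
      hnone 4 not_inHalf_four, hfull 5 inHalf_five, axisEnergy]
    have h1 := gasketEnergy_nonneg m (u ∘ F 1)
    have h2 := gasketEnergy_nonneg m (u ∘ F 5)
    have h3 := axisEnergy_nonneg m (u ∘ F 0)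
    have h4 := axisEnergy_nonneg m (u ∘ F 3)
    rw [ENNReal.ofReal_mul (by norm_num), ENNReal.ofReal_add (by positivity) h4,
      ENNReal.ofReal_add (by positivity) h3, ENNReal.ofReal_add h1 h2]
    ring

/-- The summand of `Q` with index `w`, as a function of the values at the points `p_w`. -/
def bdryTerm (P : List Bool → ℝ) (w : List Bool) : ℝ :=
  (15 / 7) ^ w.length * ((P w - P (w ++ [false])) ^ 2 + (P w - P (w ++ [true])) ^ 2)

theorem tsum_indicator_bdryTerm (n : ℕ) (P : List Bool → ℝ) :
    ∑' w, {w : List Bool | w.length < n}.indicator (fun w => ENNReal.ofReal (bdryTerm P w)) w =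
      ENNReal.ofReal (bdrySum n P) := by
  induction n generalizing P with
  | zero => simp [bdrySum]
  | succ n ih =>
    have h : ∀ i, ∑' w, {w : List Bool | w.length < n + 1}.indicator
        (fun w => ENNReal.ofReal (bdryTerm P w)) (i :: w) =
        ENNReal.ofReal (15 / 7) * ENNReal.ofReal (bdrySum n fun w => P (i :: w)) := by
      intro i
      rw [← ih, ← ENNReal.tsum_mul_left]
      refine tsum_congr fun w => ?_
      by_cases hw : w.length < n
      · rw [indicator_of_mem (by simpa using hw), indicator_of_mem (by simpa using hw),
          ← ENNReal.ofReal_mul (by norm_num)]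
        congr 1
        simp only [bdryTerm, List.length_cons, List.cons_append]
        ring
      · rw [indicator_of_notMem (by simpa using hw), indicator_of_notMem (by simpa using hw),
          mul_zero]
    have h1 := bdrySum_nonneg n fun w => P (false :: w)
    have h2 := bdrySum_nonneg n fun w => P (true :: w)
    rw [tsum_list, Fintype.sum_bool, h, h, indicator_of_mem (by simp), bdrySum,
      ENNReal.ofReal_add (by positivity) (by positivity), ENNReal.ofReal_mul (by norm_num),
      ENNReal.ofReal_add h1 h2]
    simp only [bdryTerm, List.length_nil, pow_zero, one_mul, List.nil_append]
    ring

/-- The words in the letters `0` and `3` in the index set of `Q` correspond to lists of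
Booleans. -/
def axisEquiv : List Bool ≃ {w : List (Fin 6) // ∀ i ∈ w, i = 0 ∨ i = 3} :=
  Equiv.ofBijective (fun w => ⟨axisWord w, fun i hi => by
    obtain ⟨j, -, rfl⟩ := List.mem_map.1 hi
    exact axisLetter_eq j⟩) <| by
    constructor
    · intro w w' h
      refine List.map_injective_iff.2 ?_ (congrArg Subtype.val h)
      intro i j hij
      cases i <;> cases j <;> simp [axisLetter] at hij ⊢
    · rintro ⟨w, hw⟩
      refine ⟨w.map fun i => decide (i = 3), Subtype.ext ?_⟩
      change List.map axisLetter (List.map _ w) = w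
      rw [List.map_map]
      conv_rhs => rw [← List.map_id w]
      refine List.map_congr_left fun i hi => ?_
      rcases hw i hi with rfl | rfl <;> simp [axisLetter]

theorem Q_eq (f : Plane → ℝ) : Q f = ENNReal.ofReal ((f (q 1) - f (p [])) ^ 2) +
    ∑' w, ENNReal.ofReal (bdryTerm (fun w => f (p (axisWord w))) w) := by
  rw [Q, ← axisEquiv.tsum_eq]
  congr 1
  refine tsum_congr fun w => ?_
  have h1 : (axisEquiv w).1 = axisWord w := rfl
  have h2 : ∀ i, axisWord (w ++ [i]) = axisWord w ++ [axisLetter i] := fun i => by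
    simp [axisWord]
  simp only [h1, bdryTerm, h2]
  simp [axisWord, axisLetter]

theorem le_Q (f : Plane → ℝ) (n : ℕ) :
    ENNReal.ofReal ((f (q 1) - f (p [])) ^ 2 + bdrySum n fun w => f (p (axisWord w))) ≤ Q f := by
  rw [Q_eq, ENNReal.ofReal_add (sq_nonneg _) (bdrySum_nonneg _ _), ← tsum_indicator_bdryTerm]
  gcongr with w
  exact indicator_le_self _ _ w

theorem Q_le_of_forall {f : Plane → ℝ} {B : ENNReal} (h : ∀ n, ENNReal.ofReal
    ((f (q 1) - f (p [])) ^ 2 + bdrySum n fun w => f (p (axisWord w))) ≤ B) : Q f ≤ B := by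
  rw [Q_eq, ENNReal.tsum_eq_iSup_sum, ENNReal.add_iSup]
  refine iSup_le fun s => le_trans ?_ (h (s.sup List.length + 1))
  rw [ENNReal.ofReal_add (sq_nonneg _) (bdrySum_nonneg _ _), ← tsum_indicator_bdryTerm]
  gcongr
  refine le_trans (Finset.sum_le_sum fun w hw => ?_) (ENNReal.sum_le_tsum s)
  rw [indicator_of_mem]
  exact Nat.lt_succ_of_le (Finset.le_sup (f := List.length) hw)

/-! ### The two estimates -/

theorem p_mem_halfBoundary (w : List Bool) : p (axisWord w) ∈ halfBoundary := by
  refine Or.inr ⟨Fw_mem_gasket _ (F_mem_gasket 3 (q_mem_gasket 0)), ?_⟩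
  rw [leftness_eq_zero_iff, p, leftness_axisWord, leftness_F_of_axis (Or.inr rfl), leftness_q]
  simp

theorem Fw_q_one_mem_closedHalf (w : List Bool) : Fw (axisWord w) (q 1) ∈ closedHalf := by
  refine mem_closedHalf_iff.2 ⟨Fw_mem_gasket _ (q_mem_gasket 1), ?_⟩
  rw [leftness_axisWord, leftness_q]
  simp

/-- The corner `F_w q₁` comes close to the boundary point `p_w`, and `u` is uniformly
continuous. -/
theorem IsDirichletSolution.exists_abs_sub_le {f u : Plane → ℝ} (h : IsDirichletSolution f u)
    {ε : ℝ} (hε : 0 < ε) : ∃ M, ∀ w : List Bool, M ≤ w.length →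
      |u (Fw (axisWord w) (q 1)) - f (p (axisWord w))| ≤ ε := by
  have hu := isCompact_closedHalf.uniformContinuousOn_of_continuous h.continuousOn
  obtain ⟨δ, hδ, hu⟩ := Metric.uniformContinuousOn_iff.1 hu ε hε
  set D := dist (q 1) (F 3 (q 0)) with hD
  obtain ⟨M, hM⟩ := exists_pow_lt_of_lt_one (div_pos hδ (by positivity : 0 < D + 1))
    (by norm_num : (1 / 3 : ℝ) < 1)
  refine ⟨M, fun w hw => ?_⟩
  rw [← h.boundary _ (p_mem_halfBoundary w)]
  refine (hu _ (Fw_q_one_mem_closedHalf w) _ (Or.inr (p_mem_halfBoundary w)) ?_).le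
  rw [p, dist_Fw, axisWord, List.length_map]
  rw [lt_div_iff₀ (by positivity)] at hM
  calc (1 / 3 : ℝ) ^ w.length * D ≤ (1 / 3) ^ M * (D + 1) := by
        gcongr ?_ * ?_
        · exact pow_le_pow_of_le_one (by norm_num) (by norm_num) hw
        · linarith
    _ < δ := hM

theorem IsDirichletSolution.Q_le {f u : Plane → ℝ} (h : IsDirichletSolution f u) :
    Q f ≤ ENNReal.ofReal 4 * halfEnergy u := by
  refine Q_le_of_forall fun n => ?_
  have h1 := bdrySum_le_netForm n (toNet u)
  have h2 := netForm_le_axisEnergy (n + 1) u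
  have h3 : (toNet u).p = fun w => f (p (axisWord w)) :=
    funext fun w => h.boundary _ (p_mem_halfBoundary w)
  have h4 : (toNet u).v [] = f (q 1) := h.boundary _ (Or.inl rfl)
  rw [h3, h4] at h1
  calc _ ≤ ENNReal.ofReal (4 * axisEnergy (n + 1) u) :=
        ENNReal.ofReal_le_ofReal (h1.trans (by linarith))
    _ = ENNReal.ofReal 4 * halfGraphEnergy (n + 1) u := by
        rw [ENNReal.ofReal_mul (by norm_num), halfGraphEnergy_eq]
    _ ≤ _ := by
        gcongr
        exact le_iSup (fun m => halfGraphEnergy m u) (n + 1)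

theorem IsDirichletSolution.halfEnergy_le {f u : Plane → ℝ} (h : IsDirichletSolution f u) :
    halfEnergy u ≤ ENNReal.ofReal (180 / 7) * Q f := by
  by_cases hQ : Q f = ⊤
  · rw [hQ, ENNReal.mul_top (by simp)]
    exact le_top
  refine iSup_le fun m => ?_
  rw [halfGraphEnergy_eq, axisEnergy_eq_netForm m h.harmonic.gasketHarmonic_axis]
  have hK : ∀ n, netForm n (extend (f (q 1)) fun w => f (p (axisWord w)))
      (extend (f (q 1)) fun w => f (p (axisWord w))) ≤ 45 / 7 * (Q f).toReal := by
    intro n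
    have h1 := (ENNReal.ofReal_le_iff_le_toReal hQ).1 (le_Q f n)
    have h2 := netForm_extend_le n (f (q 1)) fun w => f (p (axisWord w))
    change _ ≤ 45 / 7 * ((f (q 1) - f (p [])) ^ 2 + _) at h2
    linarith
  have h1 := netForm_le_of_harmonic (y := extend (f (q 1)) fun w => f (p (axisWord w)))
    h.harmonic.toNet_harmonic
    (fun w => h.boundary _ (p_mem_halfBoundary w))
    (h.boundary _ (Or.inl rfl)) (fun ε hε => ?_) hK m
  · calc _ ≤ ENNReal.ofReal (180 / 7 * (Q f).toReal) :=
          ENNReal.ofReal_le_ofReal (h1.trans (by linarith))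
      _ = _ := by rw [ENNReal.ofReal_mul (by norm_num), ENNReal.ofReal_toReal hQ]
  · obtain ⟨M, hM⟩ := h.exists_abs_sub_le hε
    refine ⟨M + 1, fun w hw => ?_⟩
    have hw0 : w ≠ [] := by
      rintro rfl
      simp at hw
    simpa [extend, hw0, toNet] using hM w (by omega)

end SG3

end

theorem theorem2p3 :
    ∃ C₁ C₂ : ℝ, 0 < C₁ ∧ 0 < C₂ ∧
      ∀ f u : SG3.Plane → ℝ, ContinuousOn f SG3.halfBoundary → SG3.IsDirichletSolution f u →
        ENNReal.ofReal C₁ * SG3.Q f ≤ SG3.halfEnergy u ∧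
          SG3.halfEnergy u ≤ ENNReal.ofReal C₂ * SG3.Q f := by
  refine ⟨1 / 4, 180 / 7, by norm_num, by norm_num, fun f u _ h => ⟨?_, h.halfEnergy_le⟩⟩
  calc ENNReal.ofReal (1 / 4) * SG3.Q f
      ≤ ENNReal.ofReal (1 / 4) * (ENNReal.ofReal 4 * SG3.halfEnergy u) := by
        gcongr
        exact h.Q_le
    _ = SG3.halfEnergy u := by
        rw [← mul_assoc, ← ENNReal.ofReal_mul (by norm_num)]
        norm_num
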